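/- For a finite simple graph $G=(V,E)$, a linear arrangement of $G$ is a bijection $\alpha:V\to\{1,\dots,|V|\}$; its net cost is $\sum_{uv\in E}\bigl(|\alpha(u)-\alpha(v)|-1\bigr)$, and $\mathrm{ola}^+(G)$ denotes the minimum net cost of a linear arrangement of $G$. Theorem. There is an algorithm which, given a nonnegative integer $k$ and a connected graph $G$ with $n\le 5k+2$ vertices (represented by adjacency lists), decides whether $\mathrm{ola}^+(G)\le k$ and, if $\mathrm{ola}^+(G)\le k$, computes the number $\mathrm{ola}^+(G)$, in time $O(2^{2.5551k})$. Here time is measured on a random access machine (with addition, subtraction, comparison and indirect addressing) under the logarithmic cost criterion, and the constant hidden in $O(\cdot)$ is absolute. -/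

import Mathlib

/-! ### Linear arrangements -/

/-- A linear arrangement of a graph with vertex set `V`: a one-to-one numbering of the vertices by
`|V|` consecutive integers. Positions are counted from `0` rather than from `1`; only differences
of positions are ever used. -/
abbrev LinearArrangement (V : Type*) [Fintype V] : Type _ := V ≃ Fin (Fintype.card V)

/-- The length `|α(u) - α(v)|` of an edge `uv` relative to `α`. -/
def edgeLength {V : Type*} [Fintype V] (α : LinearArrangement V) : Sym2 V → ℕ :=
  Sym2.lift ⟨fun u v => (((α u : ℕ) : ℤ) - ((α v : ℕ) : ℤ)).natAbs, fun u v => by simp only []; omega⟩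

open Classical in
/-- The net cost of `α`: the sum over all edges `e` of (length of `e`) `- 1`. Every edge of a
simple graph has length at least `1`, so the subtraction is not truncated. -/
noncomputable def netCost {V : Type*} [Fintype V] (G : SimpleGraph V) (α : LinearArrangement V) :
    ℕ :=
  ∑ e ∈ G.edgeFinset, (edgeLength α e - 1)

/-- `ola⁺(G)`: the minimum net cost of a linear arrangement of `G`. -/
noncomputable def olaPlus {V : Type*} [Fintype V] (G : SimpleGraph V) : ℕ :=
  ⨅ α : LinearArrangement V, netCost G α

/-! ### Random access machines with logarithmic cost

Programs are written in structured form (assignments, conditionals and while loops). The machine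
has registers, which are named by the program, and a memory with indirect addressing; both hold
natural numbers of arbitrary size. There is no multiplication, and every operation is charged the
bit lengths of the numbers that take part in it. -/

namespace RAM

/-- The contents of the registers and of the memory. -/
structure State where
  reg : ℕ → ℕ
  mem : ℕ → ℕ

/-- Expressions: constants, registers, memory cells with a computed address, sums, and truncated
differences. -/
inductive Expr where
  | const (c : ℕ)
  | reg (x : ℕ)
  | mem (addr : Expr)
  | add (a b : Expr)
  | sub (a b : Expr)

namespace Expr

/-- The value of an expression. -/
def eval (s : State) : Expr → ℕ
  | const c => c
  | reg x => s.reg x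
  | mem e => s.mem (eval s e)
  | add a b => eval s a + eval s b
  | sub a b => eval s a - eval s b

/-- The logarithmic cost of evaluating an expression: each constant, register access, memory access
and arithmetic operation in it costs `1` plus the bit length of its result (the bit lengths of
addresses and operands are charged to the subexpressions that produce them). -/
def cost (s : State) : Expr → ℕ
  | const c => 1 + Nat.size c
  | reg x => 1 + Nat.size (s.reg x)
  | mem e => cost s e + 1 + Nat.size (s.mem (eval s e))
  | add a b => cost s a + cost s b + 1 + Nat.size (eval s a + eval s b)
  | sub a b => cost s a + cost s b + 1 + Nat.size (eval s a - eval s b)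

end Expr

/-- Programs. In `ite` and `loop` a condition counts as true if its value is not `0`. -/
inductive Prog where
  /-- do nothing -/
  | skip
  /-- `reg x := e` -/
  | assign (x : ℕ) (e : Expr)
  /-- `mem addr := e` -/
  | store (addr e : Expr)
  /-- `p; q` -/
  | seq (p q : Prog)
  /-- `if c ≠ 0 then p else q` -/
  | ite (c : Expr) (p q : Prog)
  /-- `while c ≠ 0 do p` -/
  | loop (c : Expr) (p : Prog)

/-- `Exec p s s' t`: started in state `s`, the program `p` halts in state `s'`, and the total
(logarithmic) cost of the computation is `t`. -/
inductive Exec : Prog → State → State → ℕ → Prop where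
  | skip (s : State) : Exec .skip s s 1
  | assign (x : ℕ) (e : Expr) (s : State) :
      Exec (.assign x e) s ⟨Function.update s.reg x (e.eval s), s.mem⟩ (e.cost s + 1)
  | store (a e : Expr) (s : State) :
      Exec (.store a e) s ⟨s.reg, Function.update s.mem (a.eval s) (e.eval s)⟩
        (a.cost s + e.cost s + 1)
  | seq {p q : Prog} {s s' s'' : State} {t t' : ℕ} :
      Exec p s s' t → Exec q s' s'' t' → Exec (.seq p q) s s'' (t + t')
  | iteTrue {c : Expr} {p q : Prog} {s s' : State} {t : ℕ} :
      c.eval s ≠ 0 → Exec p s s' t → Exec (.ite c p q) s s' (c.cost s + 1 + t)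
  | iteFalse {c : Expr} {p q : Prog} {s s' : State} {t : ℕ} :
      c.eval s = 0 → Exec q s s' t → Exec (.ite c p q) s s' (c.cost s + 1 + t)
  | loopStop {c : Expr} {p : Prog} {s : State} :
      c.eval s = 0 → Exec (.loop c p) s s (c.cost s + 1)
  | loopStep {c : Expr} {p : Prog} {s s' s'' : State} {t t' : ℕ} :
      c.eval s ≠ 0 → Exec p s s' t → Exec (.loop c p) s' s'' t' →
      Exec (.loop c p) s s'' (c.cost s + 1 + t + t')

/-- The machine is deterministic: the final state and the cost are determined by the program and
the initial state. -/
theorem Exec.deterministic {p : Prog} {s s₁ s₂ : State} {t₁ t₂ : ℕ}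
    (h₁ : Exec p s s₁ t₁) (h₂ : Exec p s s₂ t₂) : s₁ = s₂ ∧ t₁ = t₂ := by
  induction h₁ generalizing s₂ t₂ with
  | skip | assign | store => cases h₂; exact ⟨rfl, rfl⟩
  | seq _ _ ih ih' =>
    cases h₂ with
    | seq g g' =>
      obtain ⟨rfl, rfl⟩ := ih g
      obtain ⟨rfl, rfl⟩ := ih' g'
      exact ⟨rfl, rfl⟩
  | iteTrue hc _ ih =>
    cases h₂ with
    | iteTrue _ g => obtain ⟨rfl, rfl⟩ := ih g; exact ⟨rfl, rfl⟩
    | iteFalse hc' _ => exact absurd hc' hc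
  | iteFalse hc _ ih =>
    cases h₂ with
    | iteTrue hc' _ => exact absurd hc hc'
    | iteFalse _ g => obtain ⟨rfl, rfl⟩ := ih g; exact ⟨rfl, rfl⟩
  | loopStop hc =>
    cases h₂ with
    | loopStop _ => exact ⟨rfl, rfl⟩
    | loopStep hc' _ _ => exact absurd hc hc'
  | loopStep hc _ _ ih ih' =>
    cases h₂ with
    | loopStop hc' => exact absurd hc' hc
    | loopStep _ g g' =>
      obtain ⟨rfl, rfl⟩ := ih g
      obtain ⟨rfl, rfl⟩ := ih' g'
      exact ⟨rfl, rfl⟩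

/-- `IsInput G k s`: the state `s` is an initial state that presents the graph `G` on the vertices
`0, …, n - 1` and the number `k` to the machine. Register `0` holds `k`, register `1` holds `n`, and
the memory holds `G` by adjacency lists: the cells `mem v, …, mem (v + 1) - 1` contain the
neighbours of the vertex `v`, each exactly once and in any order, the cells `0, …, n` contain the
boundaries of these consecutive blocks, and the first block starts right after them. All other
registers and cells are `0`. -/
structure IsInput {n : ℕ} (G : SimpleGraph (Fin n)) (k : ℕ) (s : State) : Prop where
  reg_zero : s.reg 0 = k
  reg_one : s.reg 1 = n
  reg_rest : ∀ x, 2 ≤ x → s.reg x = 0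
  first : s.mem 0 = n + 1
  mono : ∀ v < n, s.mem v ≤ s.mem (v + 1)
  vertex : ∀ i, n + 1 ≤ i → i < s.mem n → s.mem i < n
  nodup : ∀ v < n, Set.InjOn s.mem (Set.Ico (s.mem v) (s.mem (v + 1)))
  adj : ∀ v w : Fin n, G.Adj v w ↔ ∃ i ∈ Set.Ico (s.mem v) (s.mem (v + 1)), s.mem i = w
  rest : ∀ i, s.mem n ≤ i → s.mem i = 0

end RAM

/-! Build an arrangement from left to right. An edge of length ℓ passes over ℓ - 1 vertices, so the
net cost is the sum over all vertices `v` of the number of edges passing over `v`. That number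
depends only on the set `S` placed before `v`: it is the cut of `S` minus the number of neighbours
of `v` in `S` (`netCost_eq_sum_passing`, `passing_add_card`). Hence a search may forget the order
inside a prefix and explore pairs of a set and a net cost. The least cost reached with the full set
is ola⁺(G) if this is at most `k`, and otherwise the full set is not reached.

The search expands only sets `S` with `2 * cut ≤ k + 4`. This loses nothing: over a fixed gap of an
arrangement runs at most one edge of length 1 and at most two of length 2, so `2 * cut ≤ netCost +
4` (`two_mul_card_cutPairs_le`).

Few sets survive. In a connected graph, `S` is determined by the edges of a spanning tree that leave
it and by the side of one vertex, so `∑ x ^ cut ≤ 2 * (1 + x) ^ n` for `0 ≤ x ≤ 1`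
(`sum_pow_card_cutPairs_le`). With `x = 1/9` and `n ≤ 5k + 2` at most `200 * (3 * (10/9)^5)^k` sets
are expanded. Since `3 * (10/9)^5 < 5.09` and `2^2.5551 > 5.5`, there is room for every factor
polynomial in `k`.

On the machine a pair is packed into one number, and a breadth-first search uses a queue and a table
of visited codes. The table spans `(k + 1) * 2 ^ n` cells, more than the time bound allows to touch,
but memory starts out as zero and needs no clearing. Addresses have polynomially many bits, so each
round has polynomial logarithmic cost. -/

namespace RAM

/-! ### Cost calculus for programs: unit-cost counting with control of bit lengths. -/

/-- A measure of the syntactic size of an expression, which bounds its bit-length growth. -/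
def Expr.weight : Expr → ℕ
  | .const c => c + 1
  | .reg _ => 1
  | .mem e => e.weight + 1
  | .add a b => a.weight + b.weight + 1
  | .sub a b => a.weight + b.weight + 1

/-- All numbers stored in `s` have at most `L` bits. -/
def State.Bounded (L : ℕ) (s : State) : Prop :=
  ∀ x, s.reg x < 2 ^ L ∧ s.mem x < 2 ^ L

theorem State.Bounded.mono {L L' : ℕ} {s : State} (h : s.Bounded L) (hL : L ≤ L') :
    s.Bounded L' := fun x =>
  ⟨(h x).1.trans_le (Nat.pow_le_pow_right two_pos hL),
    (h x).2.trans_le (Nat.pow_le_pow_right two_pos hL)⟩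

theorem Expr.eval_lt {L : ℕ} {s : State} (h : s.Bounded L) (e : Expr) :
    e.eval s < 2 ^ (L + e.weight) := by
  induction e with
  | const c =>
    -- A constant `c` is charged `c + 1` instead of its bit length; the constants in the program are
    -- at most `4`, so nothing is lost.
    exact (Nat.lt_two_pow_self (n := c)).trans_le
      (Nat.pow_le_pow_right two_pos (by simp only [weight]; omega))
  | reg x => exact (h x).1.trans_le (Nat.pow_le_pow_right two_pos (by omega))
  | mem e => exact (h _).2.trans_le (Nat.pow_le_pow_right two_pos (by omega))
  | add a b iha ihb =>
    have h1 : 2 ^ (L + a.weight) ≤ 2 ^ (L + a.weight + b.weight) :=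
      Nat.pow_le_pow_right two_pos (by omega)
    have h2 : 2 ^ (L + b.weight) ≤ 2 ^ (L + a.weight + b.weight) :=
      Nat.pow_le_pow_right two_pos (by omega)
    have h3 : 2 ^ (L + (Expr.add a b).weight) = 2 * 2 ^ (L + a.weight + b.weight) := by
      rw [weight, ← pow_succ']; congr 1; omega
    simp only [eval]
    omega
  | sub a b iha _ =>
    have h1 : 2 ^ (L + a.weight) ≤ 2 ^ (L + (Expr.sub a b).weight) :=
      Nat.pow_le_pow_right two_pos (by simp only [weight]; omega)
    simp only [eval]
    omega

theorem Expr.cost_le {L : ℕ} {s : State} (h : s.Bounded L) (e : Expr) :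
    e.cost s ≤ e.weight * (L + e.weight + 1) := by
  have hs (e : Expr) : Nat.size (e.eval s) ≤ L + e.weight := Nat.size_le.2 (e.eval_lt h)
  induction e with
  | const c =>
    have := hs (.const c)
    simp only [cost, eval, weight] at *
    nlinarith
  | reg x =>
    have := hs (.reg x)
    simp only [cost, eval, weight] at *
    nlinarith
  | mem e ih =>
    have := hs (.mem e)
    simp only [cost, eval, weight] at *
    nlinarith
  | add a b iha ihb =>
    have := hs (.add a b)
    simp only [cost, eval, weight] at *
    nlinarith [Nat.zero_le (a.weight * b.weight)]
  | sub a b iha ihb =>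
    have := hs (.sub a b)
    simp only [cost, eval, weight] at *
    nlinarith [Nat.zero_le (a.weight * b.weight)]

/-- `p` takes `s` to `s'` in weighted unit cost `u`: numbers gain at most `u` bits, and the
logarithmic cost is bounded accordingly. -/
def Runs (p : Prog) (s s' : State) (u : ℕ) : Prop :=
  ∀ L, s.Bounded L → s'.Bounded (L + u) ∧ ∃ t, Exec p s s' t ∧ t ≤ u * (L + u + 1)

theorem Runs.mono {p : Prog} {s s' : State} {u u' : ℕ} (h : Runs p s s' u) (hu : u ≤ u') :
    Runs p s s' u' := fun L hL => by
  obtain ⟨h1, t, h2, h3⟩ := h L hL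
  exact ⟨h1.mono (by omega), t, h2, h3.trans (Nat.mul_le_mul hu (by omega))⟩

theorem Runs.skip (s : State) : Runs .skip s s 1 := fun L hL =>
  ⟨hL.mono (by omega), 1, .skip s, by nlinarith⟩

theorem Runs.assign (x : ℕ) (e : Expr) (s : State) :
    Runs (.assign x e) s ⟨Function.update s.reg x (e.eval s), s.mem⟩ (e.weight + 1) := by
  intro L hL
  refine ⟨fun y => ⟨?_, (hL.mono (by omega) y).2⟩, _, .assign x e s, ?_⟩
  · by_cases h : y = x
    · subst h
      simpa using (e.eval_lt hL).trans_le (Nat.pow_le_pow_right two_pos (by omega))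
    · simpa [h] using (hL.mono (by omega) y).1
  · have := e.cost_le hL
    nlinarith

theorem Runs.store (a e : Expr) (s : State) :
    Runs (.store a e) s ⟨s.reg, Function.update s.mem (a.eval s) (e.eval s)⟩
      (a.weight + e.weight + 1) := by
  intro L hL
  refine ⟨fun y => ⟨(hL.mono (by omega) y).1, ?_⟩, _, .store a e s, ?_⟩
  · by_cases h : y = a.eval s
    · subst h
      simpa using (e.eval_lt hL).trans_le (Nat.pow_le_pow_right two_pos (by omega))
    · simpa [h] using (hL.mono (by omega) y).2
  · have h1 := e.cost_le hL
    have h2 := a.cost_le hL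
    nlinarith [Nat.zero_le (a.weight * e.weight)]

/-- The second program starts from numbers with `L + u` bits, and `u(L+u+1) + u'(L+u+u'+1) ≤
(u+u')(L+u+u'+1)`. So weighted unit costs simply add up, and the logarithmic factor takes care of
itself. -/
theorem Runs.seq {p q : Prog} {s s' s'' : State} {u u' : ℕ} (h : Runs p s s' u)
    (h' : Runs q s' s'' u') : Runs (.seq p q) s s'' (u + u') := by
  intro L hL
  obtain ⟨h1, t, h2, h3⟩ := h L hL
  obtain ⟨h1', t', h2', h3'⟩ := h' _ h1
  refine ⟨h1'.mono (by omega), _, .seq h2 h2', ?_⟩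
  nlinarith [Nat.zero_le (u * u')]

theorem Runs.iteTrue {c : Expr} {p q : Prog} {s s' : State} {u : ℕ} (hc : c.eval s ≠ 0)
    (h : Runs p s s' u) : Runs (.ite c p q) s s' (c.weight + 1 + u) := by
  intro L hL
  obtain ⟨h1, t, h2, h3⟩ := h L hL
  refine ⟨h1.mono (by omega), _, .iteTrue hc h2, ?_⟩
  have := c.cost_le hL
  nlinarith [Nat.zero_le (u * c.weight)]

theorem Runs.iteFalse {c : Expr} {p q : Prog} {s s' : State} {u : ℕ} (hc : c.eval s = 0)
    (h : Runs q s s' u) : Runs (.ite c p q) s s' (c.weight + 1 + u) := by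
  intro L hL
  obtain ⟨h1, t, h2, h3⟩ := h L hL
  refine ⟨h1.mono (by omega), _, .iteFalse hc h2, ?_⟩
  have := c.cost_le hL
  nlinarith [Nat.zero_le (u * c.weight)]

theorem Runs.loopStop {c : Expr} {p : Prog} {s : State} (hc : c.eval s = 0) :
    Runs (.loop c p) s s (c.weight + 1) := by
  intro L hL
  refine ⟨hL.mono (by omega), _, .loopStop hc, ?_⟩
  have := c.cost_le hL
  nlinarith

theorem Runs.loopStep {c : Expr} {p : Prog} {s s' s'' : State} {u u' : ℕ} (hc : c.eval s ≠ 0)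
    (h : Runs p s s' u) (h' : Runs (.loop c p) s' s'' u') :
    Runs (.loop c p) s s'' (c.weight + 1 + u + u') := by
  intro L hL
  obtain ⟨h1, t, h2, h3⟩ := h L hL
  obtain ⟨h1', t', h2', h3'⟩ := h' _ h1
  refine ⟨h1'.mono (by omega), _, .loopStep hc h2 h2', ?_⟩
  have := c.cost_le hL
  nlinarith [Nat.zero_le (u * u'), Nat.zero_le (u * c.weight), Nat.zero_le (u' * c.weight)]

/-- The rule for counted loops with an invariant. -/
theorem Runs.loop_invariant {c : Expr} {p : Prog} (N u : ℕ) (I : ℕ → State → Prop)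
    (hstep : ∀ i < N, ∀ s, I i s → c.eval s ≠ 0 ∧ ∃ s', Runs p s s' u ∧ I (i + 1) s')
    (hend : ∀ s, I N s → c.eval s = 0) {s : State} (hs : I 0 s) :
    ∃ s', Runs (.loop c p) s s' (N * (c.weight + 1 + u) + (c.weight + 1)) ∧ I N s' := by
  -- Induction on the number `j` of remaining rounds, because a loop unfolds from the front.
  suffices H : ∀ j ≤ N, ∀ s, I (N - j) s →
      ∃ s', Runs (.loop c p) s s' (j * (c.weight + 1 + u) + (c.weight + 1)) ∧ I N s' by
    exact H N le_rfl s (by simpa using hs)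
  intro j
  induction j with
  | zero =>
    intro _ s hs
    exact ⟨s, (Runs.loopStop (hend s (by simpa using hs))).mono (by omega), by simpa using hs⟩
  | succ j ih =>
    intro hj s hs
    obtain ⟨hc, s', h1, h2⟩ := hstep _ (by omega) s hs
    rw [show N - (j + 1) + 1 = N - j by omega] at h2
    obtain ⟨s'', h3, h4⟩ := ih (by omega) s' h2
    exact ⟨s'', (Runs.loopStep hc h1 h3).mono (by linarith), h4⟩

/-- The rule for a counted loop whose states are known. -/
theorem Runs.loop_seq {c : Expr} {p : Prog} (N u : ℕ) (σ : ℕ → State)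
    (hstep : ∀ i < N, c.eval (σ i) ≠ 0 ∧ Runs p (σ i) (σ (i + 1)) u)
    (hend : c.eval (σ N) = 0) :
    Runs (.loop c p) (σ 0) (σ N) (N * (c.weight + 1 + u) + (c.weight + 1)) := by
  obtain ⟨s', h, rfl⟩ := Runs.loop_invariant (c := c) (p := p) N u (fun i s => s = σ i)
    (by rintro i hi _ rfl; exact ⟨(hstep i hi).1, _, (hstep i hi).2, rfl⟩)
    (by rintro _ rfl; exact hend) rfl
  exact h

/-- A while loop that runs at most `M` times, each time from a state with `L`-bit numbers. -/
theorem Exec.loop_bounded {c : Expr} {p : Prog} (M u L : ℕ) (I : ℕ → State → Prop)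
    (hI : ∀ i s, I i s → s.Bounded L ∧ i ≤ M)
    (hstep : ∀ i s, I i s → c.eval s ≠ 0 → ∃ s', Runs p s s' u ∧ I (i + 1) s')
    {s : State} (hs : I 0 s) :
    ∃ i s' t, Exec (.loop c p) s s' t ∧ I i s' ∧ c.eval s' = 0 ∧
      t ≤ (M + 1) * ((c.weight + 1 + u) * (L + c.weight + u + 2)) := by
  have cost_le {i s} (h : I i s) : c.cost s + 1 ≤ (c.weight + 1) * (L + c.weight + u + 2) := by
    have := c.cost_le (hI i s h).1
    nlinarith [Nat.zero_le (u * c.weight)]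
  suffices H : ∀ j i s, j + i = M → I i s → ∃ i' s' t, Exec (.loop c p) s s' t ∧ I i' s' ∧
      c.eval s' = 0 ∧ t ≤ (j + 1) * ((c.weight + 1 + u) * (L + c.weight + u + 2)) by
    exact H M 0 s (by omega) hs
  intro j
  induction j with
  | zero =>
    intro i s hj hs
    by_cases hc : c.eval s = 0
    · refine ⟨i, s, _, .loopStop hc, hs, hc, (cost_le hs).trans ?_⟩
      nlinarith [Nat.zero_le (u * (L + c.weight + u + 2))]
    · obtain ⟨s', -, h⟩ := hstep i s hs hc
      have := (hI _ _ h).2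
      omega
  | succ j ih =>
    intro i s hj hs
    by_cases hc : c.eval s = 0
    · refine ⟨i, s, _, .loopStop hc, hs, hc, (cost_le hs).trans ?_⟩
      calc _ ≤ 1 * ((c.weight + 1 + u) * (L + c.weight + u + 2)) := by
            nlinarith [Nat.zero_le (u * (L + c.weight + u + 2))]
        _ ≤ _ := Nat.mul_le_mul_right _ (by omega)
    · obtain ⟨s', h, hs'⟩ := hstep i s hs hc
      -- The same `L` serves in every round: the invariant restores it, and the bit growth allowed
      -- by `Runs` is discarded. Chaining `Runs` instead would allow `u` more bits in each of
      -- exponentially many rounds.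
      obtain ⟨-, t, h1, h2⟩ := h L (hI _ _ hs).1
      obtain ⟨i', s'', t', h3, h4, h5, h6⟩ := ih (i + 1) s' (by omega) hs'
      refine ⟨i', s'', _, .loopStep hc h1 h3, h4, h5, ?_⟩
      have h7 := cost_le hs
      have h8 : u * (L + u + 1) ≤ u * (L + c.weight + u + 2) := Nat.mul_le_mul_left _ (by omega)
      calc c.cost s + 1 + t + t' ≤ (c.weight + 1 + u) * (L + c.weight + u + 2)
            + (j + 1) * ((c.weight + 1 + u) * (L + c.weight + u + 2)) := by nlinarith
        _ = _ := by ring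

/-- Sequential composition of a list of programs. -/
def block : List Prog → Prog
  | [] => .skip
  | p :: ps => .seq p (block ps)

theorem Runs.cons {p : Prog} {ps : List Prog} {s s' s'' : State} {u u' : ℕ} (h : Runs p s s' u)
    (h' : Runs (block ps) s' s'' u') : Runs (block (p :: ps)) s s'' (u + u') := h.seq h'

theorem Runs.nil (s : State) : Runs (block []) s s 1 := .skip s

/-- The state whose first registers are the entries of `l`. -/
def State.ofList (l : List ℕ) (m : ℕ → ℕ) : State := ⟨fun x => l.getD x 0, m⟩

theorem Runs.assign_ofList {x v : ℕ} {e : Expr} {l : List ℕ} {m : ℕ → ℕ}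
    (hx : x < l.length) (he : e.eval (.ofList l m) = v) :
    Runs (.assign x e) (.ofList l m) (.ofList (l.set x v) m) (e.weight + 1) := by
  convert Runs.assign x e (.ofList l m) using 1
  simp only [State.ofList, State.mk.injEq, and_true]
  funext y
  by_cases h : y = x
  · subst h
    have : (l.set y v).getD y 0 = v := by
      simp [List.getD_eq_getElem?_getD, hx]
    simp only [this, Function.update_self]
    exact he.symm
  · simp [List.getD_eq_getElem?_getD, Function.update_of_ne h, List.getElem?_set_ne (Ne.symm h)]

theorem Runs.store_ofList {a e : Expr} {l : List ℕ} {m m' : ℕ → ℕ} (i v : ℕ)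
    (ha : a.eval (.ofList l m) = i) (he : e.eval (.ofList l m) = v)
    (hm : Function.update m i v = m') :
    Runs (.store a e) (.ofList l m) (.ofList l m') (a.weight + e.weight + 1) := by
  subst ha he hm
  exact Runs.store a e (.ofList l m)

end RAM

namespace RAM

/-! ### The memory layout -/

/-- A memory that consists of an input of length `N`, three arrays of length `n`, an array of
length `H` and an unbounded array. -/
def layout (inp : ℕ → ℕ) (N n H : ℕ) (pw mk dg vis q : ℕ → ℕ) (a : ℕ) : ℕ :=
  if a < N then inp a
  else if a < N + n then pw (a - N)
  else if a < N + n + n then mk (a - (N + n))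
  else if a < N + n + n + n then dg (a - (N + n + n))
  else if a < N + n + n + n + H then vis (a - (N + n + n + n))
  else q (a - (N + n + n + n + H))

section layout

variable {inp : ℕ → ℕ} {N n H : ℕ} {pw mk dg vis q : ℕ → ℕ}

theorem layout_inp {a : ℕ} (h : a < N) : layout inp N n H pw mk dg vis q a = inp a := by
  simp [layout, h]

theorem layout_pw {a : ℕ} (h : a < n) : layout inp N n H pw mk dg vis q (N + a) = pw a := by
  simp [layout, h]

theorem layout_mk {a : ℕ} (h : a < n) :
    layout inp N n H pw mk dg vis q (N + n + a) = mk a := by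
  unfold layout
  rw [if_neg (by omega), if_neg (by omega), if_pos (by omega)]
  congr 1; omega

theorem layout_dg {a : ℕ} (h : a < n) :
    layout inp N n H pw mk dg vis q (N + n + n + a) = dg a := by
  unfold layout
  rw [if_neg (by omega), if_neg (by omega), if_neg (by omega), if_pos (by omega)]
  congr 1; omega

theorem layout_vis {a : ℕ} (h : a < H) :
    layout inp N n H pw mk dg vis q (N + n + n + n + a) = vis a := by
  unfold layout
  rw [if_neg (by omega), if_neg (by omega), if_neg (by omega), if_neg (by omega),
    if_pos (by omega)]
  congr 1; omega

theorem layout_q (a : ℕ) :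
    layout inp N n H pw mk dg vis q (N + n + n + n + H + a) = q a := by
  unfold layout
  rw [if_neg (by omega), if_neg (by omega), if_neg (by omega), if_neg (by omega),
    if_neg (by omega)]
  congr 1; omega

theorem update_layout_pw {a x : ℕ} (h : a < n) :
    Function.update (layout inp N n H pw mk dg vis q) (N + a) x =
      layout inp N n H (Function.update pw a x) mk dg vis q := by
  funext b
  simp only [layout, Function.update_apply]
  split_ifs <;> first | rfl | omega

theorem update_layout_mk {a x : ℕ} (h : a < n) :
    Function.update (layout inp N n H pw mk dg vis q) (N + n + a) x =
      layout inp N n H pw (Function.update mk a x) dg vis q := by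
  funext b
  simp only [layout, Function.update_apply]
  split_ifs <;> first | rfl | omega

theorem update_layout_dg {a x : ℕ} (h : a < n) :
    Function.update (layout inp N n H pw mk dg vis q) (N + n + n + a) x =
      layout inp N n H pw mk (Function.update dg a x) vis q := by
  funext b
  simp only [layout, Function.update_apply]
  split_ifs <;> first | rfl | omega

theorem update_layout_vis {a x : ℕ} (h : a < H) :
    Function.update (layout inp N n H pw mk dg vis q) (N + n + n + n + a) x =
      layout inp N n H pw mk dg (Function.update vis a x) q := by
  funext b
  simp only [layout, Function.update_apply]
  split_ifs <;> first | rfl | omega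

theorem update_layout_q {a x : ℕ} :
    Function.update (layout inp N n H pw mk dg vis q) (N + n + n + n + H + a) x =
      layout inp N n H pw mk dg vis (Function.update q a x) := by
  funext b
  simp only [layout, Function.update_apply]
  split_ifs <;> first | rfl | omega

/-- Only entries below `n` matter, so a table that a loop has overwritten completely may be replaced
by the function it was filled with. -/
theorem layout_congr {pw' mk' dg' : ℕ → ℕ} (h₁ : ∀ a < n, pw a = pw' a)
    (h₂ : ∀ a < n, mk a = mk' a) (h₃ : ∀ a < n, dg a = dg' a) :
    layout inp N n H pw mk dg vis q = layout inp N n H pw' mk' dg' vis q := by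
  funext b
  unfold layout
  split_ifs
  · rfl
  · exact h₁ _ (by omega)
  · exact h₂ _ (by omega)
  · exact h₃ _ (by omega)
  · rfl
  · rfl

theorem layout_lt {B : ℕ} (hi : ∀ a < N, inp a < B) (hp : ∀ a < n, pw a < B)
    (hm : ∀ a < n, mk a < B) (hd : ∀ a < n, dg a < B) (hv : ∀ a, vis a < B) (hq : ∀ a, q a < B)
    (a : ℕ) : layout inp N n H pw mk dg vis q a < B := by
  unfold layout
  split_ifs
  · exact hi _ (by omega)
  · exact hp _ (by omega)
  · exact hm _ (by omega)
  · exact hd _ (by omega)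
  · exact hv _
  · exact hq _

end layout

/-! ### The program

Registers: `0`: `k`, `1`: `n`, `2`: start of the table of scaled powers of two, `3`: start of the
membership table, `4`: start of the table of degrees, `5`: start of the table of visited codes,
`6`: start of the queue, `7`: head of the queue, `8`: tail of the queue, `9`: current vertex,
`10`: position in an adjacency list, `11`: net cost, `12`: code of the current state, `13`: size of
the cut, `14`: degree, `15`: auxiliary. -/

/-- One step of decoding the state in register `11`. -/
def decodeStep : Prog := block [
  .assign 9 (.sub (.reg 9) (.const 1)),
  -- With truncated subtraction, `a + 1 - b` is nonzero exactly if `b ≤ a`.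
  .ite (.sub (.add (.reg 11) (.const 1)) (.mem (.add (.reg 2) (.reg 9))))
    (block [
      .assign 11 (.sub (.reg 11) (.mem (.add (.reg 2) (.reg 9)))),
      .store (.add (.reg 3) (.reg 9)) (.const 1)])
    (.store (.add (.reg 3) (.reg 9)) (.const 0))]

/-- One step of counting the marked neighbours of the current vertex. -/
def degreeStep : Prog := block [
  .assign 14 (.add (.reg 14) (.mem (.add (.reg 3) (.mem (.reg 10))))),
  .assign 10 (.add (.reg 10) (.const 1))]

/-- Compute the number of marked neighbours of the current vertex and update the cut size. -/
def cutStep : Prog := block [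
  .assign 14 (.const 0),
  .assign 10 (.mem (.reg 9)),
  .loop (.sub (.mem (.add (.reg 9) (.const 1))) (.reg 10)) degreeStep,
  .store (.add (.reg 4) (.reg 9)) (.reg 14),
  .ite (.mem (.add (.reg 3) (.reg 9))) .skip (.assign 13 (.add (.reg 13) (.reg 14))),
  .assign 9 (.add (.reg 9) (.const 1))]

/-- Mark the code in register `15` as visited and append it to the queue, if it is new. -/
def enqueue : Prog :=
  .ite (.mem (.add (.reg 5) (.reg 15))) .skip (block [
    .store (.add (.reg 5) (.reg 15)) (.const 1),
    .store (.add (.reg 6) (.reg 8)) (.reg 15),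
    .assign 8 (.add (.reg 8) (.const 1))])

/-- Try to append the current vertex to the current prefix. -/
def expandStep : Prog := block [
  .ite (.mem (.add (.reg 3) (.reg 9))) .skip (block [
    .assign 15 (.sub (.add (.reg 11) (.reg 13)) (.mem (.add (.reg 4) (.reg 9)))),
    .ite (.sub (.reg 15) (.reg 0)) .skip (block [
      -- Codes are additive: appending `v` adds `(k + 1) * 2 ^ v` for the set and cut minus degree
      -- for the cost, so no multiplication is needed.
      .assign 15 (.sub (.add (.add (.reg 12) (.mem (.add (.reg 2) (.reg 9)))) (.reg 13))
        (.mem (.add (.reg 4) (.reg 9)))),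
      enqueue])]),
  .assign 9 (.add (.reg 9) (.const 1))]

/-- Process the state at the head of the queue. -/
def searchStep : Prog := block [
  .assign 12 (.mem (.add (.reg 6) (.reg 7))),
  .assign 11 (.reg 12),
  .assign 7 (.add (.reg 7) (.const 1)),
  .assign 9 (.reg 1),
  .loop (.reg 9) decodeStep,
  .assign 13 (.const 0),
  .loop (.sub (.reg 1) (.reg 9)) cutStep,
  -- The pruning test: nonzero exactly if `2 * cut > k + 4`.
  .ite (.sub (.add (.reg 13) (.reg 13)) (.add (.reg 0) (.const 4))) .skip (block [
    .assign 9 (.const 0),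
    .loop (.sub (.reg 1) (.reg 9)) expandStep])]

/-- Fill in one scaled power of two. -/
def powerStep : Prog := block [
  .store (.add (.reg 2) (.reg 9)) (.reg 15),
  .assign 15 (.add (.reg 15) (.reg 15)),
  .assign 9 (.add (.reg 9) (.const 1))]

/-- Set up the tables and the queue. -/
def setup : Prog := block [
  -- Cell `n` holds the end of the last adjacency list, which is the first free address.
  .assign 2 (.mem (.reg 1)),
  .assign 15 (.add (.reg 0) (.const 1)),
  .loop (.sub (.reg 1) (.reg 9)) powerStep,
  .assign 3 (.add (.reg 2) (.reg 1)),
  .assign 4 (.add (.reg 3) (.reg 1)),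
  .assign 5 (.add (.reg 4) (.reg 1)),
  -- After `n` doublings register `15` holds `(k + 1) * 2 ^ n`, the number of codes and so the
  -- length of the table of visited codes.
  .assign 6 (.add (.reg 5) (.reg 15)),
  .assign 8 (.const 1),
  -- The empty prefix with net cost `0` has code `0`. The first queue cell already contains it,
  -- since unused memory is `0`.
  .store (.reg 5) (.const 1)]

/-- One step of the search for the least visited net cost of the full vertex set. -/
def answerStep : Prog := block [
  .assign 9 (.sub (.reg 9) (.const 1)),
  .ite (.mem (.add (.reg 12) (.reg 9)))
    (block [.assign 10 (.const 1), .assign 11 (.reg 9)]) .skip]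

/-- Read off the result. -/
def answer : Prog := block [
  -- The codes of the full set are the largest ones: they occupy the last `k + 1` cells before the
  -- queue.
  .assign 12 (.sub (.reg 6) (.add (.reg 0) (.const 1))),
  .assign 9 (.add (.reg 0) (.const 1)),
  .assign 10 (.const 0),
  -- The scan goes down from cost `k`, so the last hit is the least cost.
  .loop (.reg 9) answerStep,
  .assign 0 (.reg 10),
  .assign 1 (.reg 11)]

/-- The program that computes `ola⁺(G)` if it is at most `k`. -/
def olaProgram : Prog :=
  .seq setup (.seq (.loop (.sub (.reg 8) (.reg 7)) searchStep) answer)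

/-! ### The inner loops -/

/-- The indicator of the set encoded by `b`. -/
def bit (b v : ℕ) : ℕ := (b.testBit v).toNat

/-- The code of the state with prefix `b` and net cost `x`. -/
def code (k b x : ℕ) : ℕ := x + (k + 1) * b

/-- Decoding peels off bits from the top. By `code_mod_lt` the part below bit `j` is less than `(k +
1) * 2 ^ j`, so comparing with this table entry reveals bit `j`, and subtracting it removes the bit;
no division is needed. -/
theorem code_mod_succ (k b x j : ℕ) : code k (b % 2 ^ (j + 1)) x =
    code k (b % 2 ^ j) x + bit b j * ((k + 1) * 2 ^ j) := by
  have : b % 2 ^ (j + 1) = b % 2 ^ j + 2 ^ j * bit b j := by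
    rw [Nat.mod_pow_succ, bit, Nat.toNat_testBit]
  rw [code, code, this]; ring

theorem code_mod_lt {k x : ℕ} (hx : x ≤ k) (b j : ℕ) :
    code k (b % 2 ^ j) x < (k + 1) * 2 ^ j := by
  have : b % 2 ^ j + 1 ≤ 2 ^ j := Nat.mod_lt _ (by positivity)
  unfold code
  nlinarith

theorem bit_le_one (b v : ℕ) : bit b v ≤ 1 := by
  unfold bit; cases b.testBit v <;> simp

/-- A table being filled downwards, as in decoding, is the new function from a threshold on and the
old one below it; one store lowers the threshold. `update_threshold'` serves the loops that fill
upwards. -/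
theorem update_threshold (f g : ℕ → ℕ) (m : ℕ) :
    Function.update (fun v => if m + 1 ≤ v then f v else g v) m (f m) =
      fun v => if m ≤ v then f v else g v := by
  funext v
  simp only [Function.update_apply]
  split_ifs <;> first | rfl | omega | (congr 1; omega)

theorem update_threshold' (f g : ℕ → ℕ) (m : ℕ) :
    Function.update (fun v => if v < m then f v else g v) m (f m) =
      fun v => if v < m + 1 then f v else g v := by
  funext v
  simp only [Function.update_apply]
  split_ifs <;> first | rfl | omega | (congr 1; omega)

/-- The cells of `inp` below `N` describe a graph with vertices `0, …, n - 1` by adjacency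
lists. -/
structure IsAdjacency (inp : ℕ → ℕ) (N n : ℕ) : Prop where
  lt : n < N
  le : ∀ a < N, inp a ≤ N
  mono : ∀ v < n, inp v ≤ inp (v + 1)
  width : ∀ v < n, inp (v + 1) ≤ inp v + n
  offset_le : ∀ v < n, inp (v + 1) ≤ N
  vertex : ∀ v < n, ∀ i, inp v ≤ i → i < inp (v + 1) → inp i < n

/-- The number of neighbours of `v` in the set encoded by `b`. -/
def degreeIn (inp : ℕ → ℕ) (b v : ℕ) : ℕ :=
  ∑ i ∈ Finset.Ico (inp v) (inp (v + 1)), bit b (inp i)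

/-- The number of edges between the set encoded by `b` and its complement in `{0, …, j - 1}`. -/
def cutSize (inp : ℕ → ℕ) (b j : ℕ) : ℕ :=
  ∑ v ∈ Finset.range j, if b.testBit v then 0 else degreeIn inp b v

theorem cutSize_succ (inp : ℕ → ℕ) (b j : ℕ) : cutSize inp b (j + 1) =
    cutSize inp b j + if b.testBit j then 0 else degreeIn inp b j := by
  simp [cutSize, Finset.sum_range_succ]

theorem degreeIn_le_cutSize (inp : ℕ → ℕ) {b v n : ℕ} (hv : v < n) (hb : ¬ b.testBit v) :
    degreeIn inp b v ≤ cutSize inp b n := by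
  have := Finset.single_le_sum (f := fun v => if b.testBit v then 0 else degreeIn inp b v)
    (fun _ _ => Nat.zero_le _) (Finset.mem_range.2 hv)
  simpa [hb, cutSize] using this

theorem IsAdjacency.degreeIn_le {inp : ℕ → ℕ} {N n : ℕ} (h : IsAdjacency inp N n) (b : ℕ) {v : ℕ}
    (hv : v < n) : degreeIn inp b v ≤ n := by
  calc degreeIn inp b v ≤ ∑ i ∈ Finset.Ico (inp v) (inp (v + 1)), 1 :=
        Finset.sum_le_sum fun _ _ => bit_le_one _ _
    _ ≤ n := by have := h.width v hv; simp; omega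

theorem IsAdjacency.cutSize_le {inp : ℕ → ℕ} {N n : ℕ} (h : IsAdjacency inp N n) (b : ℕ) :
    cutSize inp b n ≤ n * n := by
  calc cutSize inp b n ≤ ∑ i ∈ Finset.range n, n := by
        refine Finset.sum_le_sum fun v hv => ?_
        split_ifs
        · omega
        · exact h.degreeIn_le b (Finset.mem_range.1 hv)
    _ = n * n := by simp

section loops

variable {inp : ℕ → ℕ} {N n H k : ℕ}

theorem decode_runs {b x : ℕ} (hx : x ≤ k) (hb : b < 2 ^ n) (mk dg vis q : ℕ → ℕ)
    (qb head tail i cut d w : ℕ) :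
    Runs (.loop (.reg 9) decodeStep)
      (.ofList [k, n, N, N + n, N + n + n, N + n + n + n, qb, head, tail, n, i, code k b x,
        code k b x, cut, d, w] (layout inp N n H (fun v => (k + 1) * 2 ^ v) mk dg vis q))
      (.ofList [k, n, N, N + n, N + n + n, N + n + n + n, qb, head, tail, 0, i, x,
        code k b x, cut, d, w] (layout inp N n H (fun v => (k + 1) * 2 ^ v) (bit b) dg vis q))
      (n * 40 + 2) := by
  -- After `j` rounds the bits from `n - j` on are in the table and register `11` holds the code of
  -- the remaining low part; after `n` rounds only the net cost `x` is left.
  have key := Runs.loop_seq (c := .reg 9) (p := decodeStep) n 38 (fun j =>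
    .ofList [k, n, N, N + n, N + n + n, N + n + n + n, qb, head, tail, n - j, i,
        code k (b % 2 ^ (n - j)) x, code k b x, cut, d, w]
      (layout inp N n H (fun v => (k + 1) * 2 ^ v) (fun v => if n - j ≤ v then bit b v else mk v)
        dg vis q)) ?_ ?_
  · convert key.mono ?_ using 1
    · simp only [Nat.sub_zero, Nat.mod_eq_of_lt hb]
      congr 1
      exact layout_congr (fun _ _ => rfl) (fun a ha => by rw [if_neg (by omega)]) (fun _ _ => rfl)
    · simp [Nat.mod_one, code]
    · simp [Expr.weight]
  · intro j hj
    obtain ⟨m, rfl⟩ : ∃ m, n = m + 1 + j := ⟨n - 1 - j, by omega⟩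
    have e1 : m + 1 + j - j = m + 1 := by omega
    have e2 : m + 1 + j - (j + 1) = m := by omega
    simp only [e1, e2]
    refine ⟨by simp [Expr.eval, State.ofList], ?_⟩
    have hm : m < m + 1 + j := by omega
    have hs := code_mod_succ k b x m
    have hl := code_mod_lt hx b m
    unfold decodeStep
    by_cases hbit : b.testBit m
    · have h1 : bit b m = 1 := by simp [bit, hbit]
      rw [h1, one_mul] at hs
      refine Runs.mono (Runs.cons (Runs.assign_ofList (v := m) ?_ ?_) (Runs.cons (Runs.iteTrue ?_ (Runs.cons (Runs.assign_ofList
        (v := code k (b % 2 ^ m) x) (by simp) ?_) (Runs.cons (Runs.store_ofList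
          (m' := layout inp N (m + 1 + j) H (fun v => (k + 1) * 2 ^ v)
            (fun v => if m ≤ v then bit b v else mk v) dg vis q)
          (N + (m + 1 + j) + m) (bit b m) ?_ ?_ ?_) (Runs.nil _)))) (Runs.nil _))) ?_
      · simp
      · simp [Expr.eval, State.ofList]
      · simp [Expr.eval, State.ofList, layout_pw hm]; omega
      · simp [Expr.eval, State.ofList, layout_pw hm]; omega
      · simp [Expr.eval, State.ofList]
      · simp [Expr.eval, h1]
      · rw [update_layout_mk hm, update_threshold]
      · simp [Expr.weight]
    · have h1 : bit b m = 0 := by simp [bit, hbit]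
      rw [h1, zero_mul, add_zero] at hs
      rw [hs]
      refine Runs.mono (Runs.cons (Runs.assign_ofList (v := m) ?_ ?_) (Runs.cons (Runs.iteFalse ?_ (Runs.store_ofList
          (m' := layout inp N (m + 1 + j) H (fun v => (k + 1) * 2 ^ v)
            (fun v => if m ≤ v then bit b v else mk v) dg vis q)
          (N + (m + 1 + j) + m) (bit b m) ?_ ?_ ?_)) (Runs.nil _))) ?_
      · simp
      · simp [Expr.eval, State.ofList]
      · simp [Expr.eval, State.ofList, layout_pw hm]; omega
      · simp [Expr.eval, State.ofList]
      · simp [Expr.eval, h1]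
      · rw [update_layout_mk hm, update_threshold]
      · simp [Expr.weight]
  · simp [Expr.eval, State.ofList]

theorem degree_runs (hA : IsAdjacency inp N n) (b : ℕ) {v : ℕ} (hv : v < n)
    (pw dg vis q : ℕ → ℕ) (qb head tail y z cut w : ℕ) :
    Runs (.loop (.sub (.mem (.add (.reg 9) (.const 1))) (.reg 10)) degreeStep)
      (.ofList [k, n, N, N + n, N + n + n, N + n + n + n, qb, head, tail, v, inp v, y,
        z, cut, 0, w] (layout inp N n H pw (bit b) dg vis q))
      (.ofList [k, n, N, N + n, N + n + n, N + n + n + n, qb, head, tail, v, inp (v + 1), y,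
        z, cut, degreeIn inp b v, w] (layout inp N n H pw (bit b) dg vis q))
      (n * 30 + 8) := by
  have h1 := hA.mono v hv
  have h2 := hA.width v hv
  have h3 := hA.offset_le v hv
  have hlt := hA.lt
  have key := Runs.loop_seq (c := .sub (.mem (.add (.reg 9) (.const 1))) (.reg 10))
    (p := degreeStep) (inp (v + 1) - inp v) 20 (fun j =>
    .ofList [k, n, N, N + n, N + n + n, N + n + n + n, qb, head, tail, v, inp v + j, y,
        z, cut, ∑ i ∈ Finset.Ico (inp v) (inp v + j), bit b (inp i), w]
      (layout inp N n H pw (bit b) dg vis q)) ?_ ?_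
  · convert key.mono ?_ using 1
    · simp
    · have e : inp v + (inp (v + 1) - inp v) = inp (v + 1) := by omega
      simp only [degreeIn, e]
    · simp [Expr.weight]; omega
  · intro j hj
    have h4 := hA.vertex v hv (inp v + j) (by omega) (by omega)
    refine ⟨?_, ?_⟩
    · simp [Expr.eval, State.ofList, layout_inp (show v + 1 < N by omega)]; omega
    · unfold degreeStep
      refine Runs.mono (Runs.cons (Runs.assign_ofList
        (v := ∑ i ∈ Finset.Ico (inp v) (inp v + (j + 1)), bit b (inp i)) ?_ ?_)
        (Runs.cons (Runs.assign_ofList (v := inp v + (j + 1)) ?_ ?_) (Runs.nil _))) ?_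
      · simp
      · simp [Expr.eval, State.ofList, layout_inp (show inp v + j < N by omega), layout_mk h4,
          ← add_assoc, Finset.sum_Ico_succ_top]
      · simp
      · simp [Expr.eval, State.ofList]; omega
      · simp [Expr.weight]
  · simp [Expr.eval, State.ofList, layout_inp (show v + 1 < N by omega)]; omega

/-- The final scratch values `i'` and `d'` are irrelevant to the result; their bounds are kept
because the bit bound of the search covers all registers. -/
theorem cut_runs (hA : IsAdjacency inp N n) (b : ℕ) (pw dg vis q : ℕ → ℕ)
    (qb head tail i y z d w : ℕ) :
    ∃ i' d', i' ≤ max i N ∧ d' ≤ max d n ∧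
    Runs (.loop (.sub (.reg 1) (.reg 9)) cutStep)
      (.ofList [k, n, N, N + n, N + n + n, N + n + n + n, qb, head, tail, 0, i, y, z, 0, d, w]
        (layout inp N n H pw (bit b) dg vis q))
      (.ofList [k, n, N, N + n, N + n + n, N + n + n + n, qb, head, tail, n, i', y, z,
        cutSize inp b n, d', w] (layout inp N n H pw (bit b) (degreeIn inp b) vis q))
      (n * (n * 30 + 50) + 4) := by
  have hlt := hA.lt
  have key := Runs.loop_invariant (c := .sub (.reg 1) (.reg 9))
    (p := cutStep) n (n * 30 + 46)
    (fun j s => ∃ i' d', i' ≤ max i N ∧ d' ≤ max d n ∧ s =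
      .ofList [k, n, N, N + n, N + n + n, N + n + n + n, qb, head, tail, j, i', y,
        z, cutSize inp b j, d', w]
      (layout inp N n H pw (bit b) (fun v => if v < j then degreeIn inp b v else dg v) vis q))
    ?_ ?_ ⟨i, d, by omega, by omega, rfl⟩
  · obtain ⟨s', key, i', d', hi, hd, rfl⟩ := key
    refine ⟨i', d', hi, hd, ?_⟩
    convert key.mono ?_ using 1
    · simp [cutSize]
    · congr 1
      exact layout_congr (fun _ _ => rfl) (fun _ _ => rfl) (fun a ha => by rw [if_pos ha])
    · simp [Expr.weight]; ring_nf; omega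
  · rintro j hj _ ⟨i', d', hi, hd, rfl⟩
    refine ⟨by simp [Expr.eval, State.ofList]; omega, _, ?_, inp (j + 1), degreeIn inp b j,
      (hA.offset_le j hj).trans (by omega), (hA.degreeIn_le b hj).trans (by omega), rfl⟩
    unfold cutStep
    have hdeg := fun dg y => degree_runs (k := k) (H := H) hA b hj pw dg vis q qb head tail y z
      (cutSize inp b j) w
    by_cases hbit : b.testBit j
    · have hcut : cutSize inp b (j + 1) = cutSize inp b j := by simp [cutSize_succ, hbit]
      rw [hcut]
      refine Runs.mono (Runs.cons (Runs.assign_ofList (v := 0) ?_ ?_)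
        (Runs.cons (Runs.assign_ofList (v := inp j) ?_ ?_) (Runs.cons (hdeg _ _)
        (Runs.cons (Runs.store_ofList (m' := layout inp N n H pw (bit b)
          (fun v => if v < j + 1 then degreeIn inp b v else dg v) vis q)
          (N + n + n + j) (degreeIn inp b j) ?_ ?_ ?_)
        (Runs.cons (Runs.iteTrue ?_ (Runs.skip _))
        (Runs.cons (Runs.assign_ofList (v := j + 1) ?_ ?_) (Runs.nil _))))))) ?_
      · simp
      · simp [Expr.eval]
      · simp
      · simp [Expr.eval, State.ofList, layout_inp (show j < N by omega)]
      · simp [Expr.eval, State.ofList]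
      · simp [Expr.eval, State.ofList]
      · rw [update_layout_dg hj, update_threshold']
      · simp [Expr.eval, State.ofList, layout_mk hj, bit, hbit]
      · simp
      · simp [Expr.eval, State.ofList]
      · simp [Expr.weight]; omega
    · refine Runs.mono (Runs.cons (Runs.assign_ofList (v := 0) ?_ ?_)
        (Runs.cons (Runs.assign_ofList (v := inp j) ?_ ?_) (Runs.cons (hdeg _ _)
        (Runs.cons (Runs.store_ofList (m' := layout inp N n H pw (bit b)
          (fun v => if v < j + 1 then degreeIn inp b v else dg v) vis q)
          (N + n + n + j) (degreeIn inp b j) ?_ ?_ ?_)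
        (Runs.cons (Runs.iteFalse ?_ (Runs.assign_ofList (v := cutSize inp b (j + 1)) ?_ ?_))
        (Runs.cons (Runs.assign_ofList (v := j + 1) ?_ ?_) (Runs.nil _))))))) ?_
      · simp
      · simp [Expr.eval]
      · simp
      · simp [Expr.eval, State.ofList, layout_inp (show j < N by omega)]
      · simp [Expr.eval, State.ofList]
      · simp [Expr.eval, State.ofList]
      · rw [update_layout_dg hj, update_threshold']
      · simp [Expr.eval, State.ofList, layout_mk hj, bit, hbit]
      · simp
      · simp [Expr.eval, State.ofList, cutSize_succ, hbit]
      · simp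
      · simp [Expr.eval, State.ofList]
      · simp [Expr.weight]; omega
  · rintro _ ⟨i', d', hi, hd, rfl⟩
    simp [Expr.eval, State.ofList]

end loops

end RAM

namespace RAM

/-! ### The search -/

/-- Bit `v` of `b` is `0`, so adding `2 ^ v` produces no carry. -/
theorem testBit_add_two_pow {b v : ℕ} (hb : ¬ b.testBit v) (w : ℕ) :
    (b + 2 ^ v).testBit w = (decide (w = v) || b.testBit w) := by
  obtain ⟨c, hc⟩ : ∃ c, b / 2 ^ v = 2 * c := by
    have h := Nat.toNat_testBit b v
    simp only [Bool.not_eq_true] at hb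
    rw [hb] at h
    exact ⟨b / 2 ^ v / 2, by simp at h; omega⟩
  have hm : b % 2 ^ v < 2 ^ v := Nat.mod_lt _ (by positivity)
  have h1 : b = 2 ^ v * (2 * c) + b % 2 ^ v := by rw [← hc, Nat.div_add_mod]
  have h2 : b + 2 ^ v = 2 ^ v * (2 * c + 1) + b % 2 ^ v := by
    conv_lhs => rw [h1]
    ring
  rw [h2, Nat.testBit_two_pow_mul_add _ hm]
  conv_rhs => rw [h1, Nat.testBit_two_pow_mul_add _ hm]
  rcases lt_trichotomy w v with h | rfl | h
  · simp [h, h.ne]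
  · simp
  · obtain ⟨m, hm⟩ : ∃ m, w - v = m + 1 := ⟨w - v - 1, by omega⟩
    simp only [h.not_gt, if_false, hm, h.ne', decide_false, Bool.false_or, Nat.testBit_add_one]
    congr 1; omega

theorem add_two_pow_lt {b v n : ℕ} (hb : ¬ b.testBit v) (hn : b < 2 ^ n) (hv : v < n) :
    b + 2 ^ v < 2 ^ n := by
  refine Nat.lt_pow_two_of_testBit _ fun i hi => ?_
  rw [testBit_add_two_pow hb, Nat.testBit_lt_two_pow (hn.trans_le
    (Nat.pow_le_pow_right two_pos hi))]
  simp only [Bool.or_false, decide_eq_false_iff_not]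
  omega

/-- The net cost of appending the vertex `v` to a prefix of net cost `x` encoded by `b`. -/
def stepCost (inp : ℕ → ℕ) (n b x v : ℕ) : ℕ := x + (cutSize inp b n - degreeIn inp b v)

/-- Appending `v` to the prefix encoded by `b`, of net cost `x`, is considered by the search. -/
structure IsStep (inp : ℕ → ℕ) (n k b x v : ℕ) : Prop where
  cut : 2 * cutSize inp b n ≤ k + 4
  vertex : v < n
  new : ¬ b.testBit v
  cost : stepCost inp n b x v ≤ k

/-- The pairs of a prefix and a net cost that are reached by the search. -/
inductive Reach (inp : ℕ → ℕ) (n k : ℕ) : ℕ → ℕ → Prop where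
  | zero : Reach inp n k 0 0
  | step {b x v : ℕ} : Reach inp n k b x → IsStep inp n k b x v →
      Reach inp n k (b + 2 ^ v) (stepCost inp n b x v)

theorem Reach.le {inp : ℕ → ℕ} {n k b x : ℕ} (h : Reach inp n k b x) : x ≤ k := by
  induction h with
  | zero => omega
  | step _ h _ => exact h.cost

theorem Reach.lt {inp : ℕ → ℕ} {n k b x : ℕ} (h : Reach inp n k b x) : b < 2 ^ n := by
  induction h with
  | zero => positivity
  | step _ h ih => exact add_two_pow_lt h.new ih h.vertex

theorem code_lt {k n b x : ℕ} (hb : b < 2 ^ n) (hx : x ≤ k) : code k b x < (k + 1) * 2 ^ n := by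
  unfold code; nlinarith

theorem code_inj {k b x b' x' : ℕ} (hx : x ≤ k) (hx' : x' ≤ k) (h : code k b x = code k b' x') :
    b = b' ∧ x = x' := by
  unfold code at h
  have h1 := congrArg (· / (k + 1)) h
  have h2 := congrArg (· % (k + 1)) h
  simp only [Nat.add_mul_div_left _ _ (Nat.succ_pos k), Nat.add_mul_mod_self_left,
    Nat.div_eq_of_lt (Nat.lt_succ_of_le hx), Nat.div_eq_of_lt (Nat.lt_succ_of_le hx'),
    Nat.mod_eq_of_lt (Nat.lt_succ_of_le hx), Nat.mod_eq_of_lt (Nat.lt_succ_of_le hx')] at h1 h2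
  omega

/-- The codes of the states that are reached by the search. -/
def reachCodes (inp : ℕ → ℕ) (n k : ℕ) : Set ℕ := {z | ∃ b x, Reach inp n k b x ∧ code k b x = z}

/-- The queue `q` of length `tail` lists the visited codes, all of which belong to `R`. -/
structure Queue (R : Set ℕ) (H tail : ℕ) (vis q : ℕ → ℕ) : Prop where
  mem : ∀ j < tail, q j ∈ R
  inj : Set.InjOn q (Set.Iio tail)
  vis_iff : ∀ z < H, vis z ≠ 0 ↔ ∃ j < tail, q j = z
  -- This field and the next range over all indices, used or not, because the bit bound concerns the
  -- whole memory.
  vis_le : ∀ z, vis z ≤ 1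
  lt : ∀ j, q j < H

theorem Queue.push {R : Set ℕ} {H tail : ℕ} {vis q : ℕ → ℕ} (h : Queue R H tail vis q) {w : ℕ}
    (hw : w ∈ R) (hwH : w < H) (hvis : vis w = 0) :
    Queue R H (tail + 1) (Function.update vis w 1) (Function.update q tail w) := by
  have hold : ∀ j < tail, Function.update q tail w j = q j := fun j hj =>
    Function.update_of_ne hj.ne _ _
  have hnew : ∀ j < tail, q j ≠ w := fun j hj he => (h.vis_iff w hwH).2 ⟨j, hj, he⟩ hvis
  refine ⟨fun j hj => ?_, fun i hi j hj hij => ?_, fun z hz => ?_, fun z => ?_, fun j => ?_⟩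
  · rcases Nat.lt_succ_iff_lt_or_eq.1 hj with h' | rfl
    · rw [hold j h']; exact h.mem j h'
    · simpa using hw
  · rcases Nat.lt_succ_iff_lt_or_eq.1 hi with h' | rfl <;>
      rcases Nat.lt_succ_iff_lt_or_eq.1 hj with h'' | rfl
    · rw [hold i h', hold j h''] at hij
      exact h.inj h' h'' hij
    · rw [hold i h', Function.update_self] at hij
      exact absurd hij (hnew i h')
    · rw [hold j h'', Function.update_self] at hij
      exact absurd hij.symm (hnew j h'')
    · rfl
  · by_cases hzw : z = w
    · subst hzw
      simp only [Function.update_self, ne_eq, one_ne_zero, not_false_eq_true, true_iff]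
      exact ⟨tail, by omega, by simp⟩
    · rw [Function.update_of_ne hzw, h.vis_iff z hz]
      constructor
      · rintro ⟨j, hj, rfl⟩
        exact ⟨j, by omega, hold j hj⟩
      · rintro ⟨j, hj, he⟩
        rcases Nat.lt_succ_iff_lt_or_eq.1 hj with h' | rfl
        · exact ⟨j, h', by rw [← he, hold j h']⟩
        · simp at he; exact absurd he.symm hzw
  · simp only [Function.update_apply]; split_ifs
    · exact le_rfl
    · exact h.vis_le z
  · simp only [Function.update_apply]; split_ifs
    · exact hwH
    · exact h.lt j

/-- No code is queued twice, so a set containing all reachable codes bounds the number of rounds.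
The cruder `Queue.tail_le_bound` serves only to bound bit lengths. -/
theorem Queue.tail_le {R : Set ℕ} {H tail : ℕ} {vis q : ℕ → ℕ} (h : Queue R H tail vis q)
    {F : Finset ℕ} (hF : R ⊆ F) : tail ≤ F.card := by
  simpa using Finset.card_le_card_of_injOn (s := Finset.range tail) (t := F) q
    (fun j hj => hF (h.mem j (by simpa using hj))) (by simpa using h.inj)

theorem Queue.tail_le_bound {R : Set ℕ} {H tail : ℕ} {vis q : ℕ → ℕ} (h : Queue R H tail vis q) :
    tail ≤ H := by
  simpa using Finset.card_le_card_of_injOn (s := Finset.range tail) (t := Finset.range H) q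
    (fun j _ => by simpa using h.lt j) (by simpa using h.inj)

section

variable {inp : ℕ → ℕ} {N n k : ℕ}

/-- The queue grows from `tail, vis, q` to `tail', vis', q'`. -/
structure Extends (tail : ℕ) (vis q : ℕ → ℕ) (tail' : ℕ) (vis' q' : ℕ → ℕ) : Prop where
  tail_le : tail ≤ tail'
  vis_ne : ∀ z, vis z ≠ 0 → vis' z ≠ 0
  eq : ∀ j < tail, q' j = q j

theorem Extends.refl (tail : ℕ) (vis q : ℕ → ℕ) : Extends tail vis q tail vis q :=
  ⟨le_rfl, fun _ h => h, fun _ _ => rfl⟩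

theorem Extends.trans {t t' t'' : ℕ} {v v' v'' q q' q'' : ℕ → ℕ} (h : Extends t v q t' v' q')
    (h' : Extends t' v' q' t'' v'' q'') : Extends t v q t'' v'' q'' :=
  ⟨h.tail_le.trans h'.tail_le, fun z hz => h'.vis_ne z (h.vis_ne z hz), fun j hj =>
    (h'.eq j (hj.trans_le h.tail_le)).trans (h.eq j hj)⟩

theorem enqueue_runs {R : Set ℕ} {H tail : ℕ} {vis q : ℕ → ℕ} (h : Queue R H tail vis q) {w : ℕ}
    (hw : w ∈ R) (hwH : w < H) (pw mk dg : ℕ → ℕ) (head v i y z cut d : ℕ) :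
    ∃ tail' vis' q', Queue R H tail' vis' q' ∧ Extends tail vis q tail' vis' q' ∧ vis' w ≠ 0 ∧
      Runs enqueue
        (.ofList [k, n, N, N + n, N + n + n, N + n + n + n, N + n + n + n + H, head, tail, v, i, y,
          z, cut, d, w] (layout inp N n H pw mk dg vis q))
        (.ofList [k, n, N, N + n, N + n + n, N + n + n + n, N + n + n + n + H, head, tail', v, i, y,
          z, cut, d, w] (layout inp N n H pw mk dg vis' q')) 30 := by
  by_cases hv : vis w = 0
  · refine ⟨_, _, _, h.push hw hwH hv, ⟨by omega, fun z hz => ?_, fun j hj => ?_⟩, by simp, ?_⟩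
    · simp only [Function.update_apply]; split_ifs
      · exact one_ne_zero
      · exact hz
    · exact Function.update_of_ne hj.ne _ _
    · unfold enqueue
      refine Runs.mono (Runs.iteFalse ?_ (Runs.cons (Runs.store_ofList (N + n + n + n + w) 1
        ?_ ?_ (update_layout_vis hwH)) (Runs.cons (Runs.store_ofList (N + n + n + n + H + tail) w
        ?_ ?_ update_layout_q) (Runs.cons (Runs.assign_ofList ?_ ?_) (Runs.nil _))))) ?_
      · simp [Expr.eval, State.ofList, layout_vis hwH, hv]
      · simp [Expr.eval, State.ofList]
      · simp [Expr.eval]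
      · simp [Expr.eval, State.ofList]
      · simp [Expr.eval, State.ofList]
      · simp
      · simp [Expr.eval, State.ofList]
      · simp [Expr.weight]
  · refine ⟨tail, vis, q, h, .refl _ _ _, hv, ?_⟩
    unfold enqueue
    refine Runs.mono (Runs.iteTrue ?_ (Runs.skip _)) ?_
    · simpa [Expr.eval, State.ofList, layout_vis hwH] using hv
    · simp [Expr.weight]

theorem expandStep_runs {b x j : ℕ} (hr : Reach inp n k b x)
    (hcut : 2 * cutSize inp b n ≤ k + 4) {tail : ℕ} {vis q : ℕ → ℕ}
    (hq : Queue (reachCodes inp n k) ((k + 1) * 2 ^ n) tail vis q) (hj : j < n)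
    (head i d w : ℕ) :
    ∃ tail' vis' q' w', Queue (reachCodes inp n k) ((k + 1) * 2 ^ n) tail' vis' q' ∧
      Extends tail vis q tail' vis' q' ∧
      (IsStep inp n k b x j → vis' (code k (b + 2 ^ j) (stepCost inp n b x j)) ≠ 0) ∧
      w' ≤ max w (x + cutSize inp b n + (k + 1) * 2 ^ n) ∧
      Runs expandStep
        (.ofList [k, n, N, N + n, N + n + n, N + n + n + n, N + n + n + n + (k + 1) * 2 ^ n, head,
          tail, j, i, x, code k b x, cutSize inp b n, d, w] (layout inp N n ((k + 1) * 2 ^ n)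
            (fun v => (k + 1) * 2 ^ v) (bit b) (degreeIn inp b) vis q))
        (.ofList [k, n, N, N + n, N + n + n, N + n + n + n, N + n + n + n + (k + 1) * 2 ^ n, head,
          tail', j + 1, i, x, code k b x, cutSize inp b n, d, w'] (layout inp N n ((k + 1) * 2 ^ n)
            (fun v => (k + 1) * 2 ^ v) (bit b) (degreeIn inp b) vis' q')) 90 := by
  by_cases hbit : b.testBit j
  · refine ⟨tail, vis, q, w, hq, .refl _ _ _, fun h => absurd hbit h.new, by omega, ?_⟩
    unfold expandStep
    refine Runs.mono (Runs.cons (Runs.iteTrue ?_ (Runs.skip _)) (Runs.cons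
      (Runs.assign_ofList ?_ ?_) (Runs.nil _))) ?_
    · simp [Expr.eval, State.ofList, layout_mk hj, bit, hbit]
    · simp
    · simp [Expr.eval, State.ofList]
    · simp [Expr.weight]
  have hdeg := degreeIn_le_cutSize inp hj hbit
  by_cases hcost : stepCost inp n b x j ≤ k
  · have hstep : IsStep inp n k b x j := ⟨hcut, hj, hbit, hcost⟩
    have hr' := hr.step hstep
    have hlt := code_lt hr'.lt hcost
    obtain ⟨tail', vis', q', h1, h2, h3, h4⟩ := enqueue_runs (inp := inp) (N := N) (n := n)
      (k := k) hq ⟨_, _, hr', rfl⟩ hlt (fun v => (k + 1) * 2 ^ v) (bit b) (degreeIn inp b) head j i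
      x (code k b x) (cutSize inp b n) d
    refine ⟨tail', vis', q', code k (b + 2 ^ j) (stepCost inp n b x j), h1, h2, fun _ => h3,
      by omega, ?_⟩
    unfold expandStep
    refine Runs.mono (Runs.cons (Runs.iteFalse ?_ (Runs.cons (Runs.assign_ofList
      (v := stepCost inp n b x j) ?_ ?_) (Runs.cons (Runs.iteFalse ?_ (Runs.cons
        (Runs.assign_ofList ?_ ?_) (Runs.cons h4 (Runs.nil _)))) (Runs.nil _)))) (Runs.cons
      (Runs.assign_ofList ?_ ?_) (Runs.nil _))) ?_
    · simp [Expr.eval, State.ofList, layout_mk hj, bit, hbit]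
    · simp
    · simp [Expr.eval, State.ofList, layout_dg hj, stepCost]; omega
    · simp [Expr.eval, State.ofList]; omega
    · simp
    · simp [Expr.eval, State.ofList, layout_dg hj, layout_pw hj, stepCost, code, mul_add]; omega
    · simp
    · simp [Expr.eval, State.ofList]
    · simp [Expr.weight]
  · refine ⟨tail, vis, q, stepCost inp n b x j, hq, .refl _ _ _, fun h => absurd h.cost hcost,
      by unfold stepCost; omega, ?_⟩
    unfold expandStep
    refine Runs.mono (Runs.cons (Runs.iteFalse ?_ (Runs.cons (Runs.assign_ofList
      (v := stepCost inp n b x j) ?_ ?_) (Runs.cons (Runs.iteTrue ?_ (Runs.skip _))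
        (Runs.nil _)))) (Runs.cons (Runs.assign_ofList ?_ ?_) (Runs.nil _))) ?_
    · simp [Expr.eval, State.ofList, layout_mk hj, bit, hbit]
    · simp
    · simp [Expr.eval, State.ofList, layout_dg hj, stepCost]; omega
    · simp [Expr.eval, State.ofList]; omega
    · simp
    · simp [Expr.eval, State.ofList]
    · simp [Expr.weight]

theorem expand_runs {b x : ℕ} (hr : Reach inp n k b x)
    (hcut : 2 * cutSize inp b n ≤ k + 4) {tail : ℕ} {vis q : ℕ → ℕ}
    (hq : Queue (reachCodes inp n k) ((k + 1) * 2 ^ n) tail vis q) (head i d w : ℕ) :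
    ∃ tail' vis' q' w', Queue (reachCodes inp n k) ((k + 1) * 2 ^ n) tail' vis' q' ∧
      Extends tail vis q tail' vis' q' ∧
      (∀ v, IsStep inp n k b x v → vis' (code k (b + 2 ^ v) (stepCost inp n b x v)) ≠ 0) ∧
      w' ≤ max w (x + cutSize inp b n + (k + 1) * 2 ^ n) ∧
      Runs (.loop (.sub (.reg 1) (.reg 9)) expandStep)
        (.ofList [k, n, N, N + n, N + n + n, N + n + n + n, N + n + n + n + (k + 1) * 2 ^ n, head,
          tail, 0, i, x, code k b x, cutSize inp b n, d, w] (layout inp N n ((k + 1) * 2 ^ n)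
            (fun v => (k + 1) * 2 ^ v) (bit b) (degreeIn inp b) vis q))
        (.ofList [k, n, N, N + n, N + n + n, N + n + n + n, N + n + n + n + (k + 1) * 2 ^ n, head,
          tail', n, i, x, code k b x, cutSize inp b n, d, w'] (layout inp N n ((k + 1) * 2 ^ n)
            (fun v => (k + 1) * 2 ^ v) (bit b) (degreeIn inp b) vis' q')) (n * 94 + 4) := by
  have key := Runs.loop_invariant (c := .sub (.reg 1) (.reg 9)) (p := expandStep) n 90
    (fun j s => ∃ tail' vis' q' w',
      Queue (reachCodes inp n k) ((k + 1) * 2 ^ n) tail' vis' q' ∧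
      Extends tail vis q tail' vis' q' ∧
      (∀ v < j, IsStep inp n k b x v →
        vis' (code k (b + 2 ^ v) (stepCost inp n b x v)) ≠ 0) ∧
      w' ≤ max w (x + cutSize inp b n + (k + 1) * 2 ^ n) ∧ s =
      .ofList [k, n, N, N + n, N + n + n, N + n + n + n, N + n + n + n + (k + 1) * 2 ^ n, head,
          tail', j, i, x, code k b x, cutSize inp b n, d, w'] (layout inp N n ((k + 1) * 2 ^ n)
            (fun v => (k + 1) * 2 ^ v) (bit b) (degreeIn inp b) vis' q'))
    ?_ ?_ ⟨tail, vis, q, w, hq, .refl _ _ _, fun v hv => by omega, by omega, rfl⟩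
  · obtain ⟨s', key, tail', vis', q', w', h1, h2, h3, h4, rfl⟩ := key
    exact ⟨tail', vis', q', w', h1, h2, fun v hv => h3 v hv.vertex hv, h4,
      key.mono (by simp [Expr.weight])⟩
  · rintro j hj _ ⟨tail', vis', q', w', h1, h2, h3, h4, rfl⟩
    refine ⟨by simp [Expr.eval, State.ofList]; omega, ?_⟩
    obtain ⟨tail'', vis'', q'', w'', h5, h6, h7, h8, h9⟩ :=
      expandStep_runs (N := N) hr hcut h1 hj head i d w'
    refine ⟨_, h9, tail'', vis'', q'', w'', h5, h2.trans h6, fun v hv hs => ?_, by omega, rfl⟩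
    rcases Nat.lt_succ_iff_lt_or_eq.1 hv with h | rfl
    · exact h6.vis_ne _ (h3 v h hs)
    · exact h7 hs
  · rintro _ ⟨tail', vis', q', w', -, -, -, -, rfl⟩
    simp [Expr.eval, State.ofList]

/-- The invariant of the search, when `head` states have been processed. -/
structure SearchInvariant (inp : ℕ → ℕ) (n k head tail : ℕ) (vis q : ℕ → ℕ) : Prop
    extends Queue (reachCodes inp n k) ((k + 1) * 2 ^ n) tail vis q where
  head_le : head ≤ tail
  zero : vis (code k 0 0) ≠ 0
  closed : ∀ j < head, ∀ b x, q j = code k b x → ∀ v, x ≤ k → IsStep inp n k b x v →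
    vis (code k (b + 2 ^ v) (stepCost inp n b x v)) ≠ 0

/-- With `head = tail` every queued code has been processed, so the visited codes contain the start
and are closed under steps. -/
theorem SearchInvariant.vis_of_reach {tail : ℕ} {vis q : ℕ → ℕ}
    (h : SearchInvariant inp n k tail tail vis q) {b x : ℕ} (hr : Reach inp n k b x) :
    vis (code k b x) ≠ 0 := by
  induction hr with
  | zero => exact h.zero
  | step hr hs ih =>
    obtain ⟨j, hj, he⟩ := (h.vis_iff _ (code_lt hr.lt hr.le)).1 ih
    exact h.closed j hj _ _ he _ hr.le hs

theorem SearchInvariant.vis_iff_reach {tail : ℕ} {vis q : ℕ → ℕ}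
    (h : SearchInvariant inp n k tail tail vis q) {b x : ℕ} (hb : b < 2 ^ n) (hx : x ≤ k) :
    vis (code k b x) ≠ 0 ↔ Reach inp n k b x := by
  refine ⟨fun hv => ?_, h.vis_of_reach⟩
  obtain ⟨j, hj, he⟩ := (h.vis_iff _ (code_lt hb hx)).1 hv
  obtain ⟨b', x', hr, he'⟩ := h.mem j hj
  obtain ⟨rfl, rfl⟩ := code_inj hr.le hx (he'.trans he)
  exact hr

theorem searchStep_runs (hA : IsAdjacency inp N n) {head tail : ℕ} {vis q : ℕ → ℕ}
    (hI : SearchInvariant inp n k head tail vis q) (hlt : head < tail) (mk dg : ℕ → ℕ)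
    (v i y z cut d w : ℕ) :
    ∃ tail' vis' q' v' i' y' z' cut' d' w' mk' dg',
      SearchInvariant inp n k (head + 1) tail' vis' q' ∧ v' ≤ n ∧ i' ≤ max i N ∧ y' ≤ k ∧
      z' ≤ (k + 1) * 2 ^ n ∧ cut' ≤ n * n ∧ d' ≤ max d n ∧
      w' ≤ max w (k + n * n + (k + 1) * 2 ^ n) ∧ (∀ a < n, mk' a ≤ 1) ∧ (∀ a < n, dg' a ≤ n) ∧
      Runs searchStep
        (.ofList [k, n, N, N + n, N + n + n, N + n + n + n, N + n + n + n + (k + 1) * 2 ^ n, head,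
          tail, v, i, y, z, cut, d, w] (layout inp N n ((k + 1) * 2 ^ n)
            (fun v => (k + 1) * 2 ^ v) mk dg vis q))
        (.ofList [k, n, N, N + n, N + n + n, N + n + n + n, N + n + n + n + (k + 1) * 2 ^ n,
          head + 1, tail', v', i', y', z', cut', d', w'] (layout inp N n ((k + 1) * 2 ^ n)
            (fun v => (k + 1) * 2 ^ v) mk' dg' vis' q')) (n * (n * 30 + 200) + 100) := by
  obtain ⟨b, x, hr, hz⟩ := hI.mem head hlt
  have hx := hr.le
  have hzlt := code_lt hr.lt hr.le
  have hcutle := hA.cutSize_le b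
  have hdec := decode_runs (inp := inp) (N := N) (H := (k + 1) * 2 ^ n) hx hr.lt mk dg vis q
    (N + n + n + n + (k + 1) * 2 ^ n) (head + 1) tail i cut d w
  obtain ⟨i', d', hi', hd', hcutr⟩ := cut_runs (k := k) (H := (k + 1) * 2 ^ n) hA b
    (fun v => (k + 1) * 2 ^ v) dg vis q (N + n + n + n + (k + 1) * 2 ^ n) (head + 1) tail i x
    (code k b x) d w
  by_cases hcut : 2 * cutSize inp b n ≤ k + 4
  · obtain ⟨tail', vis', q', w', h1, h2, h3, h4, h5⟩ := expand_runs (N := N) hr hcut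
      hI.toQueue (head + 1) i' d' w
    refine ⟨tail', vis', q', _, _, _, _, _, _, w', _, _, ⟨h1, hlt.trans_le h2.tail_le,
      h2.vis_ne _ hI.zero, fun j hj b' x' he v hx' hs => ?_⟩, le_rfl, hi', hx, hzlt.le, hcutle, hd',
      by omega, fun a _ => bit_le_one b a, fun a ha => hA.degreeIn_le b ha, ?_⟩
    · rcases Nat.lt_succ_iff_lt_or_eq.1 hj with h | rfl
      · rw [h2.eq j (h.trans hlt)] at he
        exact h2.vis_ne _ (hI.closed j h b' x' he v hx' hs)
      · rw [h2.eq j hlt, ← hz] at he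
        obtain ⟨rfl, rfl⟩ := code_inj hx hx' he
        exact h3 v hs
    · unfold searchStep
      refine Runs.mono (Runs.cons (Runs.assign_ofList (v := code k b x) ?_ ?_)
        (Runs.cons (Runs.assign_ofList (v := code k b x) ?_ ?_)
        (Runs.cons (Runs.assign_ofList (v := head + 1) ?_ ?_)
        (Runs.cons (Runs.assign_ofList (v := n) ?_ ?_) (Runs.cons hdec
        (Runs.cons (Runs.assign_ofList (v := 0) ?_ ?_) (Runs.cons hcutr
        (Runs.cons (Runs.iteFalse ?_ (Runs.cons (Runs.assign_ofList (v := 0) ?_ ?_)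
          (Runs.cons h5 (Runs.nil _)))) (Runs.nil _))))))))) ?_
      · simp
      · simp [Expr.eval, State.ofList, layout_q, hz]
      · simp
      · simp [Expr.eval, State.ofList]
      · simp
      · simp [Expr.eval, State.ofList]
      · simp
      · simp [Expr.eval, State.ofList]
      · simp
      · simp [Expr.eval]
      · simp [Expr.eval, State.ofList]; omega
      · simp
      · simp [Expr.eval]
      · simp [Expr.weight]; ring_nf; omega
  · refine ⟨tail, vis, q, _, _, _, _, _, _, w, _, _, ⟨hI.toQueue, hlt,
      hI.zero, fun j hj b' x' he v hx' hs => ?_⟩, le_rfl, hi', hx, hzlt.le, hcutle, hd',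
      by omega, fun a _ => bit_le_one b a, fun a ha => hA.degreeIn_le b ha, ?_⟩
    · rcases Nat.lt_succ_iff_lt_or_eq.1 hj with h | rfl
      · exact hI.closed j h b' x' he v hx' hs
      · rw [← hz] at he
        obtain ⟨rfl, rfl⟩ := code_inj hx hx' he
        -- A pruned prefix has no steps in the sense of `IsStep`, so closure holds without any
        -- enqueuing.
        exact absurd hs.cut hcut
    · unfold searchStep
      refine Runs.mono (Runs.cons (Runs.assign_ofList (v := code k b x) ?_ ?_)
        (Runs.cons (Runs.assign_ofList (v := code k b x) ?_ ?_)
        (Runs.cons (Runs.assign_ofList (v := head + 1) ?_ ?_)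
        (Runs.cons (Runs.assign_ofList (v := n) ?_ ?_) (Runs.cons hdec
        (Runs.cons (Runs.assign_ofList (v := 0) ?_ ?_) (Runs.cons hcutr
        (Runs.cons (Runs.iteTrue ?_ (Runs.skip _)) (Runs.nil _))))))))) ?_
      · simp
      · simp [Expr.eval, State.ofList, layout_q, hz]
      · simp
      · simp [Expr.eval, State.ofList]
      · simp
      · simp [Expr.eval, State.ofList]
      · simp
      · simp [Expr.eval, State.ofList]
      · simp
      · simp [Expr.eval]
      · simp [Expr.eval, State.ofList]; omega
      · simp [Expr.weight]; ring_nf; omega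

end

end RAM

/-! ### The whole program: set-up, search loop, read-out and total cost. -/

namespace RAM

section

variable {inp : ℕ → ℕ} {N n k : ℕ}

theorem State.ofList_bounded {L : ℕ} {l : List ℕ} {m : ℕ → ℕ} (hl : ∀ a ∈ l, a < 2 ^ L)
    (hm : ∀ a, m a < 2 ^ L) : (State.ofList l m).Bounded L := by
  refine fun x => ⟨?_, hm x⟩
  simp only [State.ofList, List.getD_eq_getElem?_getD]
  rcases h : l[x]? with _ | a
  · simp
  · exact hl a (List.mem_of_getElem? h)

/-- A bound for all numbers that are stored between two steps of the search. -/
def storeBound (N n k : ℕ) : ℕ := N + 3 * n + n * n + k + 2 * ((k + 1) * 2 ^ n)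

theorem search_exec (hA : IsAdjacency inp N n) {L M : ℕ} (hL : storeBound N n k < 2 ^ L)
    {F : Finset ℕ} (hF : reachCodes inp n k ⊆ F) (hM : F.card ≤ M) {tail : ℕ} {vis q : ℕ → ℕ}
    (hI : SearchInvariant inp n k 0 tail vis q) {w : ℕ} (hw : w ≤ (k + 1) * 2 ^ n) :
    ∃ tail' vis' q' v' i' y' z' cut' d' w' mk' dg' t,
      SearchInvariant inp n k tail' tail' vis' q' ∧
      t ≤ (M + 1) * ((n * (n * 30 + 200) + 104) * (L + n * (n * 30 + 200) + 105)) ∧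
      State.Bounded L
        (.ofList [k, n, N, N + n, N + n + n, N + n + n + n, N + n + n + n + (k + 1) * 2 ^ n,
          tail', tail', v', i', y', z', cut', d', w'] (layout inp N n ((k + 1) * 2 ^ n)
            (fun v => (k + 1) * 2 ^ v) mk' dg' vis' q')) ∧
      Exec (.loop (.sub (.reg 8) (.reg 7)) searchStep)
        (.ofList [k, n, N, N + n, N + n + n, N + n + n + n, N + n + n + n + (k + 1) * 2 ^ n, 0,
          tail, n, 0, 0, 0, 0, 0, w] (layout inp N n ((k + 1) * 2 ^ n)
            (fun v => (k + 1) * 2 ^ v) 0 0 vis q))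
        (.ofList [k, n, N, N + n, N + n + n, N + n + n + n, N + n + n + n + (k + 1) * 2 ^ n,
          tail', tail', v', i', y', z', cut', d', w'] (layout inp N n ((k + 1) * 2 ^ n)
            (fun v => (k + 1) * 2 ^ v) mk' dg' vis' q')) t := by
  unfold storeBound at hL
  set H := (k + 1) * 2 ^ n with hH
  have hH1 : 0 < H := by positivity
  have hlt := hA.lt
  have hbound {head tail : ℕ} {vis q : ℕ → ℕ} {v i y z cut d w : ℕ} {mk dg : ℕ → ℕ}
      (h2 : SearchInvariant inp n k head tail vis q) (h3 : v ≤ n) (h4 : i ≤ N) (h5 : y ≤ k)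
      (h6 : z ≤ H) (h7 : cut ≤ n * n) (h8 : d ≤ n) (h9 : w ≤ k + n * n + H)
      (h10 : ∀ a < n, mk a ≤ 1) (h11 : ∀ a < n, dg a ≤ n) : State.Bounded L
        (.ofList [k, n, N, N + n, N + n + n, N + n + n + n, N + n + n + n + H,
          head, tail, v, i, y, z, cut, d, w] (layout inp N n H
            (fun v => (k + 1) * 2 ^ v) mk dg vis q)) := by
    have ht := h2.toQueue.tail_le_bound
    rw [← hH] at ht
    have hh := h2.head_le
    refine State.ofList_bounded ?_ (layout_lt (fun a ha => ?_) (fun a ha => ?_) (fun a ha => ?_)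
      (fun a ha => ?_) (fun a => ?_) (fun a => ?_))
    · simp only [List.mem_cons, List.not_mem_nil, or_false, forall_eq_or_imp, forall_eq]
      refine ⟨?_, ?_, ?_, ?_, ?_, ?_, ?_, ?_, ?_, ?_, ?_, ?_, ?_, ?_, ?_, ?_⟩ <;> omega
    · have := hA.le a ha
      omega
    · have : (k + 1) * 2 ^ a ≤ H :=
        Nat.mul_le_mul_left _ (Nat.pow_le_pow_right two_pos ha.le)
      omega
    · have := h10 a ha
      omega
    · have := h11 a ha
      omega
    · have := h2.vis_le a
      omega
    · have := h2.lt a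
      omega
  -- The round counter is `head`, which never exceeds `tail ≤ F.card ≤ M`.
  have key := Exec.loop_bounded (c := .sub (.reg 8) (.reg 7)) (p := searchStep) M
    (n * (n * 30 + 200) + 100) L
    (fun head s => ∃ tail vis q v i y z cut d w mk dg,
      SearchInvariant inp n k head tail vis q ∧ v ≤ n ∧ i ≤ N ∧ y ≤ k ∧ z ≤ H ∧ cut ≤ n * n ∧
      d ≤ n ∧ w ≤ k + n * n + H ∧ (∀ a < n, mk a ≤ 1) ∧ (∀ a < n, dg a ≤ n) ∧ s =
      .ofList [k, n, N, N + n, N + n + n, N + n + n + n, N + n + n + n + H, head, tail, v, i, y,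
        z, cut, d, w] (layout inp N n H (fun v => (k + 1) * 2 ^ v) mk dg vis q)) ?_ ?_
    ⟨tail, vis, q, n, 0, 0, 0, 0, 0, w, 0, 0, hI, le_rfl, by omega, by omega, by omega, by omega,
      by omega, by omega, by simp, by simp, rfl⟩
  · rw [← hH] at *
    obtain ⟨head, s', t, h1, ⟨tail', vis', q', v', i', y', z', cut', d', w', mk', dg', h2, h3, h4, h5,
      h6, h7, h8, h9, h10, h11, rfl⟩, h12, h13⟩ := key
    have hhead : head = tail' := by
      have := h2.head_le
      simp [Expr.eval, State.ofList] at h12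
      omega
    subst hhead
    refine ⟨head, vis', q', v', i', y', z', cut', d', w', mk', dg', t, h2, h13.trans ?_, ?_, h1⟩
    · simp only [Expr.weight]
      refine Nat.mul_le_mul_left _ (Nat.mul_le_mul ?_ ?_) <;> omega
    · exact hbound h2 h3 h4 h5 h6 h7 h8 h9 h10 h11
  · rintro head _ ⟨tail, vis, q, v, i, y, z, cut, d, w, mk, dg, h2, h3, h4, h5, h6, h7, h8, h9, h10,
      h11, rfl⟩
    exact ⟨hbound h2 h3 h4 h5 h6 h7 h8 h9 h10 h11,
      h2.head_le.trans ((h2.toQueue.tail_le hF).trans hM)⟩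
  · rintro head _ ⟨tail, vis, q, v, i, y, z, cut, d, w, mk, dg, h2, h3, h4, h5, h6, h7, h8, h9, h10,
      h11, rfl⟩ hc
    obtain ⟨tail', vis', q', v', i', y', z', cut', d', w', mk', dg', g1, g2, g3, g4, g5, g6, g7, g8,
      g9, g10, g11⟩ := searchStep_runs hA h2 (by simp [Expr.eval, State.ofList] at hc; omega) mk dg
        v i y z cut d w
    exact ⟨_, g11, tail', vis', q', v', i', y', z', cut', d', w', mk', dg', g1, g2, by omega, g4, g5,
      g6, by omega, by omega, g9, g10, rfl⟩

theorem power_runs :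
    Runs (.loop (.sub (.reg 1) (.reg 9)) powerStep)
      (.ofList [k, n, N, 0, 0, 0, 0, 0, 0, 0, 0, 0, 0, 0, 0, k + 1]
        (layout inp N n ((k + 1) * 2 ^ n) 0 0 0 0 0))
      (.ofList [k, n, N, 0, 0, 0, 0, 0, 0, n, 0, 0, 0, 0, 0, (k + 1) * 2 ^ n]
        (layout inp N n ((k + 1) * 2 ^ n) (fun v => (k + 1) * 2 ^ v) 0 0 0 0))
      (n * 24 + 4) := by
  have key := Runs.loop_seq (c := .sub (.reg 1) (.reg 9)) (p := powerStep) n 20 (fun j =>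
    .ofList [k, n, N, 0, 0, 0, 0, 0, 0, j, 0, 0, 0, 0, 0, (k + 1) * 2 ^ j]
      (layout inp N n ((k + 1) * 2 ^ n)
        (fun v => if v < j then (k + 1) * 2 ^ v else (0 : ℕ → ℕ) v) 0 0 0 0)) ?_ ?_
  · convert key.mono ?_ using 1
    · simp; rfl
    · congr 1
      exact layout_congr (fun a ha => by simp [ha]) (fun _ _ => rfl) (fun _ _ => rfl)
    · simp [Expr.weight]
  · intro j hj
    refine ⟨by simp [Expr.eval, State.ofList]; omega, ?_⟩
    unfold powerStep
    refine Runs.mono (Runs.cons (Runs.store_ofList (N + j) ((k + 1) * 2 ^ j) ?_ ?_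
      ((update_layout_pw hj).trans (by rw [update_threshold' (fun v => (k + 1) * 2 ^ v)])))
      (Runs.cons (Runs.assign_ofList ?_ ?_) (Runs.cons (Runs.assign_ofList ?_ ?_)
        (Runs.nil _)))) ?_
    · simp [Expr.eval, State.ofList]
    · simp [Expr.eval, State.ofList]
    · simp
    · simp [Expr.eval, State.ofList, pow_succ]; ring
    · simp
    · simp [Expr.eval, State.ofList]
    · simp [Expr.weight]
  · simp [Expr.eval, State.ofList]

theorem setup_runs (hA : IsAdjacency inp N n) (hN : inp n = N) :
    Runs setup
      (.ofList [k, n, 0, 0, 0, 0, 0, 0, 0, 0, 0, 0, 0, 0, 0, 0]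
        (layout inp N n ((k + 1) * 2 ^ n) 0 0 0 0 0))
      (.ofList [k, n, N, N + n, N + n + n, N + n + n + n, N + n + n + n + (k + 1) * 2 ^ n, 0,
          1, n, 0, 0, 0, 0, 0, (k + 1) * 2 ^ n] (layout inp N n ((k + 1) * 2 ^ n)
            (fun v => (k + 1) * 2 ^ v) 0 0 (Function.update 0 0 1) 0))
      (n * 24 + 50) := by
  have hH1 : 0 < (k + 1) * 2 ^ n := by positivity
  unfold setup
  refine Runs.mono (Runs.cons (Runs.assign_ofList (v := N) ?_ ?_)
    (Runs.cons (Runs.assign_ofList (v := k + 1) ?_ ?_) (Runs.cons (power_runs)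
    (Runs.cons (Runs.assign_ofList (v := N + n) ?_ ?_)
    (Runs.cons (Runs.assign_ofList (v := N + n + n) ?_ ?_)
    (Runs.cons (Runs.assign_ofList (v := N + n + n + n) ?_ ?_)
    (Runs.cons (Runs.assign_ofList (v := N + n + n + n + (k + 1) * 2 ^ n) ?_ ?_)
    (Runs.cons (Runs.assign_ofList (v := 1) ?_ ?_)
    (Runs.cons (Runs.store_ofList (N + n + n + n + 0) 1 ?_ ?_ (update_layout_vis hH1))
      (Runs.nil _)))))))))) ?_
  all_goals first
    | (simp [Expr.weight]; done)
    | (simp [Expr.weight]; omega)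
    | (simp [Expr.eval, State.ofList, layout_inp hA.lt, hN])

theorem searchInvariant_init : SearchInvariant inp n k 0 1 (Function.update 0 0 1) 0 where
  mem j hj := ⟨0, 0, .zero, by simp [code]⟩
  inj i hi j hj _ := by simp at hi hj; omega
  vis_iff z hz := by
    by_cases h : z = 0
    · subst h; simp
    · simp [h, Ne.symm h]
  vis_le z := by simp only [Function.update_apply]; split_ifs <;> simp
  lt j := by simp
  head_le := by omega
  zero := by simp [code]
  closed j hj := by omega

theorem answer_runs {tail : ℕ} {vis q : ℕ → ℕ} (hI : SearchInvariant inp n k tail tail vis q)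
    (mk dg : ℕ → ℕ) (v i y z cut d w : ℕ) :
    ∃ s', Runs answer
        (.ofList [k, n, N, N + n, N + n + n, N + n + n + n, N + n + n + n + (k + 1) * 2 ^ n,
          tail, tail, v, i, y, z, cut, d, w] (layout inp N n ((k + 1) * 2 ^ n)
            (fun v => (k + 1) * 2 ^ v) mk dg vis q)) s' (k * 40 + 100) ∧
      (∀ x, IsLeast {x | Reach inp n k (2 ^ n - 1) x} x → s'.reg 0 = 1 ∧ s'.reg 1 = x) ∧
      ((∀ x, ¬ Reach inp n k (2 ^ n - 1) x) → s'.reg 0 = 0) := by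
  set A := N + n + n + n + (k + 1) * 2 ^ n - (k + 1) with hA
  have hpow : 1 ≤ 2 ^ n := Nat.one_le_two_pow
  have hfull : (k + 1) * (2 ^ n - 1) = (k + 1) * 2 ^ n - (k + 1) := by
    rw [Nat.mul_sub, mul_one]
  have hle : k + 1 ≤ (k + 1) * 2 ^ n := Nat.le_mul_of_pos_right _ (by positivity)
  have haddr : ∀ x, A + x = N + n + n + n + code k (2 ^ n - 1) x := fun x => by
    rw [code, hfull]; omega
  have hread : ∀ x ≤ k, layout inp N n ((k + 1) * 2 ^ n) (fun v => (k + 1) * 2 ^ v) mk dg vis q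
      (A + x) ≠ 0 ↔ Reach inp n k (2 ^ n - 1) x := fun x hx => by
    rw [haddr, layout_vis (code_lt (by omega) hx), hI.vis_iff_reach (by omega) hx]
  have key := Runs.loop_invariant (c := .reg 9) (p := answerStep) (k + 1) 30 (fun j s => ∃ i y,
    s = .ofList [k, n, N, N + n, N + n + n, N + n + n + n, N + n + n + n + (k + 1) * 2 ^ n,
          tail, tail, k + 1 - j, i, y, A, cut, d, w] (layout inp N n ((k + 1) * 2 ^ n)
            (fun v => (k + 1) * 2 ^ v) mk dg vis q) ∧
      ((i = 0 ∧ ∀ x, k + 1 - j ≤ x → ¬ Reach inp n k (2 ^ n - 1) x) ∨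
        (i = 1 ∧ IsLeast {x | k + 1 - j ≤ x ∧ Reach inp n k (2 ^ n - 1) x} y))) ?_ ?_
    ⟨0, y, rfl, Or.inl ⟨rfl, fun x hx hr => by have := hr.le; omega⟩⟩
  · obtain ⟨_, key, i', y', rfl, h⟩ := key
    simp only [Nat.sub_self, Nat.zero_le, true_and, forall_const] at h key
    have hrun : Runs answer
        (.ofList [k, n, N, N + n, N + n + n, N + n + n + n, N + n + n + n + (k + 1) * 2 ^ n,
          tail, tail, v, i, y, z, cut, d, w] (layout inp N n ((k + 1) * 2 ^ n)
            (fun v => (k + 1) * 2 ^ v) mk dg vis q))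
        (.ofList [i', y', N, N + n, N + n + n, N + n + n + n, N + n + n + n + (k + 1) * 2 ^ n,
          tail, tail, 0, i', y', A, cut, d, w] (layout inp N n ((k + 1) * 2 ^ n)
            (fun v => (k + 1) * 2 ^ v) mk dg vis q)) (k * 40 + 100) := by
      unfold answer
      refine Runs.mono (Runs.cons (Runs.assign_ofList (v := A) ?_ ?_)
        (Runs.cons (Runs.assign_ofList (v := k + 1) ?_ ?_)
        (Runs.cons (Runs.assign_ofList (v := 0) ?_ ?_) (Runs.cons key
        (Runs.cons (Runs.assign_ofList (v := i') ?_ ?_)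
        (Runs.cons (Runs.assign_ofList (v := y') ?_ ?_) (Runs.nil _))))))) ?_
      all_goals first
        | (simp [Expr.weight]; done)
        | (simp [Expr.weight]; omega)
        | (simp [Expr.eval, State.ofList, hA])
    refine ⟨_, hrun, ?_⟩
    rcases h with ⟨rfl, h⟩ | ⟨rfl, h⟩
    · exact ⟨fun x hx => absurd hx.1 (h x), fun _ => by simp [State.ofList]⟩
    · exact ⟨fun x hx => ⟨by simp [State.ofList], by simpa [State.ofList] using h.unique hx⟩,
          fun h' => absurd h.1 (h' _)⟩
  · rintro j hj _ ⟨i', y', rfl, h⟩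
    refine ⟨by simp [Expr.eval, State.ofList]; omega, ?_⟩
    have hm : k + 1 - j - 1 = k + 1 - (j + 1) := by omega
    by_cases hr : Reach inp n k (2 ^ n - 1) (k + 1 - (j + 1))
    · refine ⟨_, ?_, 1, k + 1 - (j + 1), rfl, Or.inr ⟨rfl, ⟨le_rfl, hr⟩, fun x hx => hx.1⟩⟩
      unfold answerStep
      refine Runs.mono (Runs.cons (Runs.assign_ofList (v := k + 1 - (j + 1)) ?_ ?_)
        (Runs.cons (Runs.iteTrue ?_ (Runs.cons (Runs.assign_ofList (v := 1) ?_ ?_)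
        (Runs.cons (Runs.assign_ofList (v := k + 1 - (j + 1)) ?_ ?_) (Runs.nil _))))
        (Runs.nil _))) ?_
      · simp
      · simp [Expr.eval, State.ofList]; omega
      · exact (hread (k + 1 - (j + 1)) (by omega)).2 hr
      · simp
      · simp [Expr.eval]
      · simp
      · simp [Expr.eval, State.ofList]
      · simp [Expr.weight]
    · refine ⟨_, ?_, i', y', rfl, ?_⟩
      · unfold answerStep
        refine Runs.mono (Runs.cons (Runs.assign_ofList (v := k + 1 - (j + 1)) ?_ ?_)
          (Runs.cons (Runs.iteFalse ?_ (Runs.skip _)) (Runs.nil _))) ?_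
        · simp
        · simp [Expr.eval, State.ofList]; omega
        · exact not_not.1 fun h => hr ((hread (k + 1 - (j + 1)) (by omega)).1 h)
        · simp [Expr.weight]
      · have hx : ∀ x, Reach inp n k (2 ^ n - 1) x → (k + 1 - j ≤ x ↔ k + 1 - (j + 1) ≤ x) := by
          intro x hx
          have : x ≠ k + 1 - (j + 1) := by rintro rfl; exact hr hx
          omega
        have hset : {x | k + 1 - (j + 1) ≤ x ∧ Reach inp n k (2 ^ n - 1) x} =
            {x | k + 1 - j ≤ x ∧ Reach inp n k (2 ^ n - 1) x} := by
          ext x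
          simp only [Set.mem_ofPred_eq, and_congr_left_iff]
          exact fun h => (hx x h).symm
        rw [hset]
        exact h.imp_left fun h => ⟨h.1, fun x hle h' => h.2 x ((hx x h').2 hle) h'⟩
  · rintro _ ⟨i', y', rfl, h⟩
    simp [Expr.eval, State.ofList]

theorem olaProgram_exec (hA : IsAdjacency inp N n) (hN : inp n = N) (hinp : ∀ i, N ≤ i → inp i = 0)
    {L M : ℕ} (hL : storeBound N n k < 2 ^ L) {F : Finset ℕ} (hF : reachCodes inp n k ⊆ F)
    (hM : F.card ≤ M) {s : State} (h0 : s.reg 0 = k) (h1 : s.reg 1 = n)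
    (hreg : ∀ x, 2 ≤ x → s.reg x = 0) (hmem : s.mem = inp) :
    ∃ s' t, Exec olaProgram s s' t ∧
      t ≤ (n * 24 + 50) * (L + (n * 24 + 50) + 1) +
        (M + 1) * ((n * (n * 30 + 200) + 104) * (L + n * (n * 30 + 200) + 105)) +
        (k * 40 + 100) * (L + (k * 40 + 100) + 1) ∧
      (∀ x, IsLeast {x | Reach inp n k (2 ^ n - 1) x} x → s'.reg 0 = 1 ∧ s'.reg 1 = x) ∧
      ((∀ x, ¬ Reach inp n k (2 ^ n - 1) x) → s'.reg 0 = 0) := by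
  have hs : s = .ofList [k, n, 0, 0, 0, 0, 0, 0, 0, 0, 0, 0, 0, 0, 0, 0]
      (layout inp N n ((k + 1) * 2 ^ n) 0 0 0 0 0) := by
    obtain ⟨reg, mem⟩ := s
    simp only [State.ofList, State.mk.injEq] at *
    subst hmem
    refine ⟨funext fun x => ?_, funext fun x => ?_⟩
    · rcases x with _ | _ | x
      · simpa using h0
      · simpa using h1
      · rw [hreg _ (by omega)]
        iterate 14 (rcases x with _ | x; · rfl)
        rfl
    · unfold layout
      split_ifs
      · rfl
      all_goals exact hinp x (by omega)
  subst hs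
  have hb : State.Bounded L (.ofList [k, n, 0, 0, 0, 0, 0, 0, 0, 0, 0, 0, 0, 0, 0, 0]
      (layout inp N n ((k + 1) * 2 ^ n) 0 0 0 0 0)) := by
    unfold storeBound at hL
    refine State.ofList_bounded ?_ (layout_lt (fun a ha => ?_) (fun a ha => ?_) (fun a ha => ?_)
      (fun a ha => ?_) (fun a => ?_) (fun a => ?_))
    · simp only [List.mem_cons, List.not_mem_nil, or_false, forall_eq_or_imp, forall_eq]
      refine ⟨?_, ?_, ?_, ?_, ?_, ?_, ?_, ?_, ?_, ?_, ?_, ?_, ?_, ?_, ?_, ?_⟩ <;> omega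
    · have := hA.le a ha
      omega
    all_goals simp
  obtain ⟨-, t₁, e₁, b₁⟩ := setup_runs (k := k) hA hN L hb
  obtain ⟨tail, vis, q, v, i, y, z, cut, d, w, mk, dg, t₂, hI, b₂, hb₂, e₂⟩ :=
    search_exec hA hL hF hM searchInvariant_init le_rfl
  obtain ⟨s', hr, hans⟩ := answer_runs (N := N) hI mk dg v i y z cut d w
  obtain ⟨-, t₃, e₃, b₃⟩ := hr L hb₂
  refine ⟨s', _, e₁.seq (e₂.seq e₃), ?_, hans⟩
  omega

end

end RAM

/-! ### Net cost as a sum over vertices, and cuts of arrangements. -/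

open Classical in
/-- The ordered pairs of adjacent vertices that lead out of `S`. -/
noncomputable def cutPairs {V : Type*} [Fintype V] (G : SimpleGraph V) (S : Finset V) :
    Finset (V × V) :=
  Finset.univ.filter fun p => G.Adj p.1 p.2 ∧ p.1 ∈ S ∧ p.2 ∉ S

open Classical in
/-- The number of edges that pass over `v` when `v` is placed right after the vertices of `S`. -/
noncomputable def passing {V : Type*} [Fintype V] (G : SimpleGraph V) (S : Finset V) (v : V) : ℕ :=
  (Finset.univ.filter fun p : V × V => G.Adj p.1 p.2 ∧ p.1 ∈ S ∧ p.2 ∉ S ∧ p.2 ≠ v).card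

section arrangements

open Finset

variable {V : Type*} [Fintype V] (G : SimpleGraph V)

theorem mem_cutPairs {S : Finset V} {p : V × V} :
    p ∈ cutPairs G S ↔ G.Adj p.1 p.2 ∧ p.1 ∈ S ∧ p.2 ∉ S := by
  simp [cutPairs]

-- The edges leaving `S` either end at `v` or pass over it. This justifies the formula for
-- `stepCost`.
open Classical in
theorem passing_add_card {S : Finset V} {v : V} (hv : v ∉ S) :
    passing G S v + (S.filter (G.Adj v)).card = (cutPairs G S).card := by
  rw [← Finset.card_filter_add_card_filter_not (s := cutPairs G S) (fun p => p.2 ≠ v)]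
  congr 1
  · rw [passing, cutPairs, filter_filter]
    congr 1; ext p; simp; tauto
  · refine Finset.card_bij (fun u _ => (u, v)) ?_ ?_ ?_
    · intro u hu
      simp only [mem_filter] at hu
      simp [mem_cutPairs, hu.1, hv, hu.2.symm]
    · intro a _ b _ h
      exact (Prod.mk.inj h).1
    · rintro ⟨a, b⟩ h
      simp only [mem_filter, mem_cutPairs, not_not] at h
      obtain ⟨⟨h1, h2, h3⟩, rfl⟩ := h
      exact ⟨a, by simp [h2, h1.symm], rfl⟩

open Classical in
theorem netCost_eq_sum_pairs (α : LinearArrangement V) :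
    netCost G α = ∑ p ∈ univ.filter (fun p : V × V => G.Adj p.1 p.2 ∧ α p.1 < α p.2),
      ((α p.2 : ℕ) - α p.1 - 1) := by
  symm
  refine Finset.sum_bij (fun p _ => s(p.1, p.2)) ?_ ?_ ?_ ?_
  · rintro ⟨a, b⟩ h
    simp only [mem_filter, mem_univ, true_and] at h
    simpa using h.1
  · rintro ⟨a, b⟩ h ⟨c, d⟩ h' he
    simp only [mem_filter, mem_univ, true_and] at h h'
    rw [Sym2.eq_iff] at he
    rcases he with ⟨rfl, rfl⟩ | ⟨rfl, rfl⟩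
    · rfl
    · exact absurd h.2 h'.2.not_gt
  · intro e he
    induction e with
    | _ a b =>
      have hab : G.Adj a b := by simpa using he
      rcases lt_trichotomy (α a) (α b) with h | h | h
      · exact ⟨(a, b), by simp [hab, h], rfl⟩
      · exact absurd (α.injective h) hab.ne
      · exact ⟨(b, a), by simp [hab.symm, h], Sym2.eq_swap⟩
  · rintro ⟨a, b⟩ h
    simp only [mem_filter, mem_univ, true_and] at h
    have := Fin.lt_def.1 h.2
    simp only [edgeLength, Sym2.lift_mk]
    omega

theorem card_filter_between (α : LinearArrangement V) (a b : V) :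
    (univ.filter fun v => α a < α v ∧ α v < α b).card = (α b : ℕ) - α a - 1 := by
  rw [← Fin.card_Ioo]
  refine Finset.card_bij (fun v _ => α v) (by simp) (fun _ _ _ _ h => α.injective h) ?_
  intro j hj
  exact ⟨α.symm j, by simpa using hj, by simp⟩

/-- Double counting of pairs of an edge and a vertex strictly between its ends; an edge of length ℓ
has ℓ - 1 such vertices. -/
theorem netCost_eq_sum_passing (α : LinearArrangement V) :
    netCost G α = ∑ v, passing G (univ.filter fun u => α u < α v) v := by
  classical
  rw [netCost_eq_sum_pairs]
  simp only [← card_filter_between]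
  simp only [Finset.card_filter _ (univ : Finset V)]
  rw [Finset.sum_comm]
  refine Finset.sum_congr rfl fun v _ => ?_
  rw [← Finset.card_filter, filter_filter, passing]
  congr 1
  ext ⟨a, b⟩
  simp only [mem_filter, mem_univ, true_and, not_lt]
  constructor
  · rintro ⟨⟨h1, h2⟩, h3, h4⟩
    exact ⟨h1, h3, h4.le, fun h => by subst h; exact lt_irrefl _ h4⟩
  · rintro ⟨h1, h2, h3, h4⟩
    have h5 := h3.lt_of_ne fun h => h4 (α.injective h).symm
    exact ⟨⟨h1, h2.trans h5⟩, h2, h5⟩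

/-- At most one edge over a cut of an arrangement has length one, and at most two have length
two. -/
theorem two_mul_card_cutPairs_le (α : LinearArrangement V) (i : ℕ) :
    2 * (cutPairs G (univ.filter fun u => (α u : ℕ) < i)).card ≤ netCost G α + 4 := by
  classical
  set C := cutPairs G (univ.filter fun u => (α u : ℕ) < i) with hC
  have hmem : ∀ p ∈ C, G.Adj p.1 p.2 ∧ (α p.1 : ℕ) < i ∧ i ≤ (α p.2 : ℕ) := fun p hp => by
    simpa [hC, mem_cutPairs] using hp
  have h1 : ∑ p ∈ C, ((α p.2 : ℕ) - α p.1 - 1) ≤ netCost G α := by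
    rw [netCost_eq_sum_pairs]
    refine Finset.sum_le_sum_of_subset fun p hp => ?_
    have := hmem p hp
    simp only [mem_filter, mem_univ, true_and, Fin.lt_def]
    exact ⟨this.1, by omega⟩
  have h2 (a b : ℕ) : ∑ p ∈ C, (if (α p.1 : ℕ) = a ∧ (α p.2 : ℕ) = b then 1 else 0) ≤ 1 := by
    rw [← Finset.card_filter, Finset.card_le_one]
    rintro ⟨u, v⟩ h ⟨u', v'⟩ h'
    simp only [mem_filter] at h h'
    exact Prod.ext (α.injective (Fin.ext (h.2.1.trans h'.2.1.symm)))
      (α.injective (Fin.ext (h.2.2.trans h'.2.2.symm)))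
  -- An edge over gap `i` contributes at least `2` unless it joins positions `(i-1, i)`, of length
  -- 1, or `(i-2, i)` or `(i-1, i+1)`, of length 2. The corrections `2`, `1`, `1` make up for these,
  -- and by `h2` they total at most `4`. Truncation of `i - 1` and `i - 2` is harmless: extra
  -- corrections only weaken the inequality.
  have h3 : ∑ p ∈ C, 2 ≤ ∑ p ∈ C, (((α p.2 : ℕ) - α p.1 - 1) +
      2 * (if (α p.1 : ℕ) = i - 1 ∧ (α p.2 : ℕ) = i then 1 else 0) +
      (if (α p.1 : ℕ) = i - 2 ∧ (α p.2 : ℕ) = i then 1 else 0) +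
      (if (α p.1 : ℕ) = i - 1 ∧ (α p.2 : ℕ) = i + 1 then 1 else 0)) := by
    refine Finset.sum_le_sum fun p hp => ?_
    have := hmem p hp
    split_ifs <;> omega
  rw [Finset.sum_add_distrib, Finset.sum_add_distrib, Finset.sum_add_distrib, ← Finset.mul_sum,
    Finset.sum_const, smul_eq_mul] at h3
  have := h2 (i - 1) i
  have := h2 (i - 2) i
  have := h2 (i - 1) (i + 1)
  omega

end arrangements

/-! ### Counting vertex sets with small cut in a connected graph. -/

section counting

open Finset

variable {V : Type*} [Fintype V]

open Classical in
/-- The edges of `T` that leave `S`. -/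
noncomputable def edgeCut (T : SimpleGraph V) (S : Finset V) : Finset (Sym2 V) :=
  (cutPairs T S).image fun p => s(p.1, p.2)

theorem mem_edgeCut {T : SimpleGraph V} {S : Finset V} {a b : V} :
    s(a, b) ∈ edgeCut T S ↔ T.Adj a b ∧ (a ∈ S ↔ b ∉ S) := by
  simp only [edgeCut, mem_image, mem_cutPairs, Prod.exists, Sym2.eq_iff]
  constructor
  · rintro ⟨c, d, ⟨h1, h2, h3⟩, ⟨rfl, rfl⟩ | ⟨rfl, rfl⟩⟩
    · exact ⟨h1, by tauto⟩
    · exact ⟨h1.symm, by tauto⟩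
  · rintro ⟨h1, h2⟩
    by_cases ha : a ∈ S
    · exact ⟨a, b, ⟨h1, ha, h2.1 ha⟩, Or.inl ⟨rfl, rfl⟩⟩
    · exact ⟨b, a, ⟨h1.symm, by tauto, ha⟩, Or.inr ⟨rfl, rfl⟩⟩

theorem card_edgeCut_le {T G : SimpleGraph V} (h : T ≤ G) (S : Finset V) :
    (edgeCut T S).card ≤ (cutPairs G S).card := by
  classical
  refine Finset.card_image_le.trans (Finset.card_le_card fun p hp => ?_)
  rw [mem_cutPairs] at *
  exact ⟨h hp.1, hp.2⟩

/-- Along a walk from `r`, membership in `S` changes exactly at the edges of the cut, so the cut and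
the side of `r` determine `S`. -/
theorem eq_of_edgeCut_eq {T : SimpleGraph V} (hT : T.Connected) {S S' : Finset V} (r : V)
    (hr : r ∈ S ↔ r ∈ S') (h : edgeCut T S = edgeCut T S') : S = S' := by
  ext v
  obtain ⟨w⟩ := hT.preconnected r v
  induction w with
  | nil => exact hr
  | cons hadj _ ih =>
    rename_i a b c _
    refine ih ?_
    have := (mem_edgeCut (T := T) (S := S) (a := a) (b := b))
    rw [h, mem_edgeCut] at this
    tauto

/-- Passing to a spanning tree shrinks cuts, which increases `x ^ cut` because `x ≤ 1`. There `S` is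
encoded injectively by a set of tree edges and one bit, and the sum over all sets of tree edges is a
binomial expansion. -/
theorem sum_pow_card_cutPairs_le {G : SimpleGraph V} (hG : G.Connected) {x : ℝ} (hx : 0 ≤ x)
    (hx1 : x ≤ 1) :
    ∑ S : Finset V, x ^ (cutPairs G S).card ≤ 2 * (x + 1) ^ Fintype.card V := by
  classical
  obtain ⟨T, hTG, hT⟩ := hG.exists_isTree_le
  obtain ⟨r⟩ := hG.nonempty
  set P := T.edgeFinset.powerset ×ˢ (univ : Finset Bool) with hP
  calc ∑ S : Finset V, x ^ (cutPairs G S).card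
      ≤ ∑ S : Finset V, x ^ (edgeCut T S).card :=
        Finset.sum_le_sum fun S _ => pow_le_pow_of_le_one hx hx1 (card_edgeCut_le hTG S)
    _ = ∑ q ∈ univ.image (fun S : Finset V => (edgeCut T S, decide (r ∈ S))),
          x ^ q.1.card := by
        rw [Finset.sum_image]
        intro S _ S' _ h
        simp only [Prod.mk.injEq, decide_eq_decide] at h
        exact eq_of_edgeCut_eq hT.connected r h.2 h.1
    _ ≤ ∑ q ∈ P, x ^ q.1.card := by
        refine Finset.sum_le_sum_of_subset_of_nonneg ?_ fun _ _ _ => by positivity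
        intro q hq
        obtain ⟨S, -, rfl⟩ := Finset.mem_image.1 hq
        simp only [hP, mem_product, mem_powerset, mem_univ, and_true]
        intro e he
        induction e with
        | _ a b => simpa using (mem_edgeCut.1 he).1
    _ = 2 * (x + 1) ^ T.edgeFinset.card := by
        rw [hP, Finset.sum_product, ← Finset.sum_pow_mul_eq_add_pow]
        simp [Finset.mul_sum]
    _ ≤ 2 * (x + 1) ^ Fintype.card V := by
        have := hT.card_edgeFinset
        gcongr
        · linarith
        · omega

/-- Every set counted contributes at least `(1/9)^cut ≥ (1/3)^k` to the generating function at `x =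
1/9`. This `x` minimizes `x^(-k/2) * (1 + x)^(5k)`, the growth relevant for `n ≈ 5k`. -/
theorem card_filter_cutPairs_le {G : SimpleGraph V} (hG : G.Connected) (k : ℕ) :
    ((univ.filter fun S : Finset V => 2 * (cutPairs G S).card ≤ k).card : ℝ) ≤
      2 * 3 ^ k * (10 / 9) ^ Fintype.card V := by
  have h := sum_pow_card_cutPairs_le hG (x := 1 / 9) (by norm_num) (by norm_num)
  have h1 : ∑ S ∈ univ.filter (fun S : Finset V => 2 * (cutPairs G S).card ≤ k),
      ((1 : ℝ) / 3) ^ k ≤ ∑ S : Finset V, ((1 : ℝ) / 9) ^ (cutPairs G S).card := by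
    refine (Finset.sum_le_sum fun S hS => ?_).trans
      (Finset.sum_le_sum_of_subset_of_nonneg (Finset.filter_subset _ _)
        fun _ _ _ => by positivity)
    rw [show (1 : ℝ) / 9 = (1 / 3) ^ 2 by norm_num, ← pow_mul]
    exact pow_le_pow_of_le_one (by norm_num) (by norm_num) (mem_filter.1 hS).2
  rw [Finset.sum_const, nsmul_eq_mul] at h1
  have h2 := h1.trans h
  rw [one_div, inv_pow, ← div_eq_mul_inv, div_le_iff₀ (by positivity)] at h2
  norm_num at h2 ⊢
  linarith

end counting

/-! ### Correctness of the search and the number of codes it can reach. -/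

namespace RAM

open Finset

/-- The set of vertices encoded by `b`. -/
def bitSet (n b : ℕ) : Finset (Fin n) := univ.filter fun v => b.testBit v

theorem mem_bitSet {n b : ℕ} {v : Fin n} : v ∈ bitSet n b ↔ b.testBit v := by simp [bitSet]

theorem bitSet_add_two_pow {n b : ℕ} {v : Fin n} (hv : v ∉ bitSet n b) :
    bitSet n (b + 2 ^ (v : ℕ)) = insert v (bitSet n b) := by
  ext w
  rw [mem_bitSet, testBit_add_two_pow (by rwa [mem_bitSet] at hv), mem_insert, mem_bitSet]
  simp [Fin.ext_iff]

theorem bitSet_injOn (n : ℕ) : Set.InjOn (bitSet n) {b | b < 2 ^ n} := by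
  intro b hb c hc h
  refine Nat.eq_of_testBit_eq fun i => ?_
  by_cases hi : i < n
  · have := congrArg (⟨i, hi⟩ ∈ ·) h
    simpa only [mem_bitSet, eq_iff_iff, Bool.coe_iff_coe] using this
  · have hp : 2 ^ n ≤ 2 ^ i := Nat.pow_le_pow_right two_pos (by omega)
    rw [Nat.testBit_lt_two_pow (lt_of_lt_of_le hb hp), Nat.testBit_lt_two_pow (lt_of_lt_of_le hc hp)]

theorem bitSet_two_pow_sub_one (n : ℕ) : bitSet n (2 ^ n - 1) = univ := by
  ext v
  simp [mem_bitSet, Nat.testBit_two_pow_sub_one]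

section input

variable {n k : ℕ} {G : SimpleGraph (Fin n)} {s : State}

theorem IsInput.mem_mono (h : IsInput G k s) {v w : ℕ} (hvw : v ≤ w) (hw : w ≤ n) :
    s.mem v ≤ s.mem w := by
  induction w, hvw using Nat.le_induction with
  | base => rfl
  | succ w _ ih => exact (ih (by omega)).trans (h.mono w (by omega))

theorem IsInput.le_mem (h : IsInput G k s) {v : ℕ} (hv : v ≤ n) : n + 1 ≤ s.mem v :=
  h.first ▸ h.mem_mono (Nat.zero_le v) hv

theorem IsInput.isAdjacency (h : IsInput G k s) : IsAdjacency s.mem (s.mem n) n where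
  lt := h.le_mem le_rfl
  le a ha := by
    by_cases hn : a ≤ n
    · exact h.mem_mono hn le_rfl
    · have := h.vertex a (by omega) ha
      have := h.le_mem le_rfl
      omega
  mono := h.mono
  width v hv := by
    have := Finset.card_le_card_of_injOn (s := Ico (s.mem v) (s.mem (v + 1))) (t := range n) s.mem
      (fun i hi => by
        rw [mem_coe, mem_Ico] at hi
        have h1 := h.le_mem hv.le
        have h2 := h.mem_mono (show v + 1 ≤ n from hv) le_rfl
        simpa using h.vertex i (by omega) (by omega))
      (by simpa using h.nodup v hv)
    simp at this
    omega
  offset_le v hv := h.mem_mono hv le_rfl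
  vertex v hv i hi hi' := by
    have h1 := h.le_mem hv.le
    have h2 := h.mem_mono (show v + 1 ≤ n from hv) le_rfl
    exact h.vertex i (by omega) (by omega)

theorem IsInput.mem_le (h : IsInput G k s) : s.mem n ≤ n + 1 + n * n := by
  suffices ∀ v ≤ n, s.mem v ≤ n + 1 + v * n from this n le_rfl
  intro v
  induction v with
  | zero => intro _; simp [h.first]
  | succ v ih =>
    intro hv
    have h1 := ih (by omega)
    have h2 := h.isAdjacency.width v hv
    rw [add_mul]
    omega

open Classical in
theorem IsInput.degreeIn_eq (h : IsInput G k s) (b : ℕ) (v : Fin n) :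
    degreeIn s.mem b v = ((bitSet n b).filter (G.Adj v)).card := by
  have hvert := h.isAdjacency.vertex v v.2
  have hsum : degreeIn s.mem b v =
      ((Ico (s.mem v) (s.mem (v + 1))).filter fun i => b.testBit (s.mem i)).card := by
    rw [Finset.card_filter, degreeIn]
    refine Finset.sum_congr rfl fun i _ => ?_
    unfold bit
    cases b.testBit (s.mem i) <;> rfl
  rw [hsum]
  refine Finset.card_bij (fun i hi => ⟨s.mem i, ?_⟩) ?_ ?_ ?_
  · simp only [mem_filter, mem_Ico] at hi
    exact hvert i hi.1.1 hi.1.2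
  · intro i hi
    simp only [mem_filter, mem_Ico] at hi
    simp only [mem_filter, mem_bitSet]
    exact ⟨hi.2, (h.adj _ _).2 ⟨i, hi.1, rfl⟩⟩
  · intro i hi j hj hij
    simp only [mem_filter, mem_Ico] at hi hj
    exact h.nodup v v.2 hi.1 hj.1 (Fin.mk.inj_iff.1 hij)
  · intro w hw
    simp only [mem_filter, mem_bitSet] at hw
    obtain ⟨i, hi, hiw⟩ := (h.adj v w).1 hw.2
    exact ⟨i, by simpa [hiw, hw.1] using hi, Fin.ext hiw⟩

theorem IsInput.cutSize_eq (h : IsInput G k s) (b : ℕ) :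
    cutSize s.mem b n = (cutPairs G (bitSet n b)).card := by
  classical
  rw [cutSize, Finset.sum_range, Finset.card_eq_sum_card_fiberwise (f := Prod.snd) (t := univ)
    (by simp)]
  refine Finset.sum_congr rfl fun v _ => ?_
  rw [h.degreeIn_eq]
  by_cases hv : b.testBit v
  · rw [if_pos hv, eq_comm, Finset.card_eq_zero, Finset.filter_eq_empty_iff]
    rintro p hp rfl
    exact ((mem_cutPairs G).1 hp).2.2 (mem_bitSet.2 hv)
  · rw [if_neg hv]
    refine Finset.card_bij (fun u _ => (u, v)) ?_ ?_ ?_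
    · intro u hu
      simp only [mem_filter] at hu
      simp [mem_cutPairs, hu.1, hu.2.symm, mem_bitSet, hv]
    · intro a _ c _ hac
      exact (Prod.mk.inj hac).1
    · rintro ⟨a, c⟩ hp
      simp only [mem_filter, mem_cutPairs] at hp
      obtain ⟨⟨h1, h2, -⟩, rfl⟩ := hp
      exact ⟨a, by simp [h2, h1.symm], rfl⟩

theorem IsInput.stepCost_eq (h : IsInput G k s) {b : ℕ} (x : ℕ) {v : Fin n}
    (hv : v ∉ bitSet n b) : stepCost s.mem n b x v = x + passing G (bitSet n b) v := by
  classical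
  have := passing_add_card G hv
  rw [stepCost, h.cutSize_eq, h.degreeIn_eq]
  omega

/-- Every state reached by the search is given by an arrangement of its prefix. -/
theorem IsInput.exists_position (h : IsInput G k s) {b x : ℕ} (hr : Reach s.mem n k b x) :
    ∃ f : Fin n → ℕ, Set.InjOn f (bitSet n b) ∧ (∀ v ∈ bitSet n b, f v < (bitSet n b).card) ∧
      x = ∑ v ∈ bitSet n b, passing G ((bitSet n b).filter fun u => f u < f v) v := by
  induction hr with
  | zero => exact ⟨0, by simp [bitSet], by simp [bitSet], by simp [bitSet]⟩
  | @step b x v hr hs ih =>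
    obtain ⟨f, hf, hlt, hx⟩ := ih
    obtain ⟨v, rfl⟩ : ∃ w : Fin n, (w : ℕ) = v := ⟨⟨v, hs.vertex⟩, rfl⟩
    have hv : v ∉ bitSet n b := fun h => hs.new (mem_bitSet.1 h)
    rw [bitSet_add_two_pow hv, h.stepCost_eq x hv]
    set S := bitSet n b with hS
    have hne : ∀ u ∈ S, u ≠ v := fun u hu huv => hv (huv ▸ hu)
    have hold : ∀ u ∈ S, Function.update f v S.card u = f u := fun u hu =>
      Function.update_of_ne (hne u hu) _ _
    -- The new vertex takes the first free position, behind all of `S`; hence the sets preceding the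
    -- older vertices, and so their summands, do not change.
    refine ⟨Function.update f v S.card, ?_, ?_, ?_⟩
    · rw [coe_insert, Set.injOn_insert hv]
      refine ⟨hf.congr fun u hu => (hold u hu).symm, ?_⟩
      rintro ⟨u, hu, he⟩
      rw [hold u hu, Function.update_self] at he
      exact (hlt u hu).ne he
    · intro u hu
      rw [card_insert_of_notMem hv]
      rcases mem_insert.1 hu with rfl | hu
      · simp
      · rw [hold u hu]
        exact (hlt u hu).trans (Nat.lt_succ_self _)
    · rw [sum_insert hv, add_comm, hx]
      congr 1
      · congr 1
        rw [Function.update_self, filter_insert, Function.update_self, if_neg (lt_irrefl _)]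
        refine (filter_true_of_mem fun u hu => ?_).symm
        rw [hold u hu]
        exact hlt u hu
      · refine sum_congr rfl fun u hu => ?_
        congr 1
        rw [hold u hu, filter_insert, Function.update_self, if_neg (hlt u hu).not_gt]
        exact filter_congr fun w hw => by rw [hold w hw]

theorem IsInput.exists_arrangement (h : IsInput G k s) {x : ℕ}
    (hr : Reach s.mem n k (2 ^ n - 1) x) : ∃ α : LinearArrangement (Fin n), netCost G α = x := by
  obtain ⟨f, hf, hlt, hx⟩ := h.exists_position hr
  rw [bitSet_two_pow_sub_one] at hf hlt hx
  have hinj : Function.Injective fun v => (⟨f v, hlt v (mem_univ v)⟩ : Fin (Fintype.card (Fin n))) :=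
    fun a c hac => hf (by simp) (by simp) (Fin.mk.inj_iff.1 hac)
  refine ⟨Equiv.ofBijective _ ((Fintype.bijective_iff_injective_and_card _).2 ⟨hinj, by simp⟩), ?_⟩
  rw [netCost_eq_sum_passing, hx]
  simp [Fin.lt_def]

/-- Completeness of the pruned search: every prefix of an arrangement of net cost at most `k` passes
the cut test by `two_mul_card_cutPairs_le`, and its cost is a partial sum of
`netCost_eq_sum_passing`, hence at most `k`. -/
theorem IsInput.reach_prefix (h : IsInput G k s) {α : LinearArrangement (Fin n)}
    (hα : netCost G α ≤ k) {i : ℕ} (hi : i ≤ n) :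
    ∃ b, bitSet n b = (univ.filter fun u => (α u : ℕ) < i) ∧ Reach s.mem n k b
      (∑ v ∈ univ.filter (fun v => (α v : ℕ) < i), passing G (univ.filter fun u => α u < α v) v) := by
  induction i with
  | zero => exact ⟨0, by simp [bitSet], by simpa using Reach.zero⟩
  | succ i ih =>
    obtain ⟨b, hb, hr⟩ := ih (by omega)
    set v := α.symm ⟨i, by simpa using hi⟩ with hv
    have hαv : (α v : ℕ) = i := by simp [hv]
    have hvb : v ∉ bitSet n b := by simp [hb, hαv]
    have hset : univ.filter (fun u => (α u : ℕ) < i + 1) =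
        insert v (univ.filter fun u => (α u : ℕ) < i) := by
      ext u
      simp only [mem_filter, mem_univ, true_and, mem_insert, Nat.lt_succ_iff_lt_or_eq]
      rw [or_comm]
      refine or_congr_left ⟨fun hu => α.injective (Fin.ext (hu.trans hαv.symm)), ?_⟩
      rintro rfl
      exact hαv
    have hprefix : (univ.filter fun u => α u < α v) = bitSet n b := by
      simp only [hb, Fin.lt_def, hαv]
    have hcost := h.stepCost_eq (∑ v ∈ univ.filter (fun v => (α v : ℕ) < i),
      passing G (univ.filter fun u => α u < α v) v) hvb
    have hsum : ∑ v ∈ univ.filter (fun v => (α v : ℕ) < i + 1),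
        passing G (univ.filter fun u => α u < α v) v = stepCost s.mem n b
          (∑ v ∈ univ.filter (fun v => (α v : ℕ) < i),
            passing G (univ.filter fun u => α u < α v) v) v := by
      rw [hcost, hset, sum_insert (by simp [hαv]), hprefix, add_comm]
    refine ⟨b + 2 ^ (v : ℕ), by rw [bitSet_add_two_pow hvb, hset, hb], ?_⟩
    rw [hsum]
    refine hr.step ⟨?_, v.2, fun hbit => hvb (mem_bitSet.2 hbit), ?_⟩
    · rw [h.cutSize_eq, hb]
      exact (two_mul_card_cutPairs_le G α i).trans (by omega)
    · rw [← hsum]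
      refine le_trans ?_ hα
      rw [netCost_eq_sum_passing]
      exact sum_le_sum_of_subset (filter_subset _ _)

theorem IsInput.reach_full_of_netCost_le (h : IsInput G k s) {α : LinearArrangement (Fin n)}
    (hα : netCost G α ≤ k) : Reach s.mem n k (2 ^ n - 1) (netCost G α) := by
  obtain ⟨b, hb, hr⟩ := h.reach_prefix hα le_rfl
  have huniv : (univ.filter fun u => (α u : ℕ) < n) = univ :=
    filter_true_of_mem fun u _ => (α u).2.trans_eq (Fintype.card_fin n)
  rw [huniv] at hb hr
  rw [← netCost_eq_sum_passing] at hr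
  have := bitSet_injOn n hr.lt (show 2 ^ n - 1 < 2 ^ n by have := Nat.one_le_two_pow (n := n); omega)
    (hb.trans (bitSet_two_pow_sub_one n).symm)
  rwa [this] at hr

theorem IsInput.isLeast_reach (h : IsInput G k s) (hk : olaPlus G ≤ k) :
    IsLeast {x | Reach s.mem n k (2 ^ n - 1) x} (olaPlus G) := by
  have : Nonempty (LinearArrangement (Fin n)) := ⟨Fintype.equivFin _⟩
  obtain ⟨α, hα⟩ : ∃ α, netCost G α = olaPlus G := Nat.sInf_mem (Set.range_nonempty (netCost G))
  refine ⟨?_, fun x hx => ?_⟩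
  · have := h.reach_full_of_netCost_le (hα.trans_le hk)
    rwa [hα] at this
  · obtain ⟨β, rfl⟩ := h.exists_arrangement hx
    exact Nat.sInf_le ⟨β, rfl⟩

theorem IsInput.not_reach (h : IsInput G k s) (hk : ¬ olaPlus G ≤ k) (x : ℕ) :
    ¬ Reach s.mem n k (2 ^ n - 1) x := fun hr => by
  obtain ⟨β, hβ⟩ := h.exists_arrangement hr
  have h1 : olaPlus G ≤ netCost G β := Nat.sInf_le ⟨β, rfl⟩
  have h2 := hr.le
  omega

/-- The prefixes that are reached by the search are obtained from prefixes with small cut by adding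
at most one vertex. -/
theorem IsInput.exists_reachCodes_subset (h : IsInput G k s) :
    ∃ F : Finset ℕ, reachCodes s.mem n k ⊆ F ∧ F.card ≤ (1 + n * (univ.filter
      fun S : Finset (Fin n) => 2 * (cutPairs G S).card ≤ k + 4).card) * (k + 1) := by
  classical
  set B := (range (2 ^ n)).filter fun b => 2 * cutSize s.mem b n ≤ k + 4 with hB
  have hBcard : B.card ≤ (univ.filter
      fun S : Finset (Fin n) => 2 * (cutPairs G S).card ≤ k + 4).card := by
    refine Finset.card_le_card_of_injOn (bitSet n) (fun b hb => ?_)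
      ((bitSet_injOn n).mono fun b hb => ?_)
    · simp only [hB, coe_filter, Set.mem_ofPred_eq, h.cutSize_eq] at hb
      simpa using hb.2
    · simp only [hB, coe_filter, Set.mem_ofPred_eq, mem_range] at hb
      exact hb.1
  -- The cut test applies to the prefix being expanded, not to the one produced, which costs the
  -- factor `n`; the possible net costs give the factor `k + 1`.
  set P := insert 0 ((range n ×ˢ B).image fun p => p.2 + 2 ^ p.1) with hP
  refine ⟨(P ×ˢ range (k + 1)).image fun p => code k p.1 p.2, ?_, ?_⟩
  · rintro _ ⟨b, x, hr, rfl⟩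
    refine mem_coe.2 (mem_image.2 ⟨(b, x), mem_product.2 ⟨?_, ?_⟩, rfl⟩)
    · cases hr with
      | zero => simp [hP]
      | step hr hs =>
        refine mem_insert_of_mem (mem_image.2 ⟨(_, _), mem_product.2 ⟨mem_range.2 hs.vertex,
          mem_filter.2 ⟨mem_range.2 hr.lt, hs.cut⟩⟩, rfl⟩)
    · simpa [Nat.lt_succ_iff] using hr.le
  · refine card_image_le.trans ?_
    rw [card_product, card_range]
    refine Nat.mul_le_mul_right _ ((card_insert_le _ _).trans ?_)
    have := (card_image_le (s := range n ×ˢ B) (f := fun p => p.2 + 2 ^ p.1)).trans_eq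
      (card_product _ _)
    rw [card_range] at this
    have := Nat.mul_le_mul_left n hBcard
    omega

end input

end RAM

/-! ### Numerical estimates and the final time bound. -/

theorem exists_pow_mul_pow_le (d : ℕ) {r R : ℝ} (hr : 0 < r) (hR : r < R) :
    ∃ C : ℝ, 0 ≤ C ∧ ∀ k : ℕ, ((k : ℝ) + 1) ^ d * r ^ k ≤ C * R ^ k := by
  have hq0 : 0 < r / R := div_pos hr (hr.trans hR)
  have hq1 : r / R < 1 := (div_lt_one (hr.trans hR)).2 hR
  have ht := tendsto_pow_const_mul_const_pow_of_abs_lt_one d (r := r / R)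
    (by rwa [abs_of_pos hq0])
  obtain ⟨C, hC⟩ := ht.bddAbove_range
  have hC' : ∀ m : ℕ, (m : ℝ) ^ d * (r / R) ^ m ≤ C := fun m => hC ⟨m, rfl⟩
  have hC0 : 0 ≤ C := le_trans (by positivity) (hC' 0)
  -- The bound on `m ^ d * (r / R) ^ m` is used at `m = k + 1`, which leaves one factor `r / R` to
  -- divide out.
  refine ⟨C / (r / R), by positivity, fun k => ?_⟩
  have h := hC' (k + 1)
  rw [div_mul_eq_mul_div, le_div_iff₀ hq0]
  have hRk : 0 < R ^ k := pow_pos (hr.trans hR) k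
  calc ((k : ℝ) + 1) ^ d * r ^ k * (r / R)
      = (((k + 1 : ℕ) : ℝ) ^ d * (r / R) ^ (k + 1)) * R ^ k := by
        push_cast
        rw [pow_succ (r / R), div_pow]
        field_simp
    _ ≤ C * R ^ k := by gcongr

/-- The base `11/2` lies strictly above `300000/59049 ≈ 5.08`, so polynomial factors fit in between,
and below `2^(5/2)`, because `(11/2)^2 = 30.25 ≤ 32`. -/
theorem pow_le_two_rpow (k : ℕ) : (11 / 2 : ℝ) ^ k ≤ (2 : ℝ) ^ ((2.5551 : ℝ) * (k : ℝ)) := by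
  rw [Real.rpow_mul (by norm_num), Real.rpow_natCast]
  refine pow_le_pow_left₀ (by norm_num) ?_ k
  calc (11 / 2 : ℝ) ≤ (2 : ℝ) ^ ((5 : ℝ) / 2) := by
        refine le_of_sq_le_sq ?_ (by positivity)
        rw [← Real.rpow_natCast ((2 : ℝ) ^ _), ← Real.rpow_mul (by norm_num)]
        norm_num
    _ ≤ _ := Real.rpow_le_rpow_of_exponent_le (by norm_num) (by norm_num)

namespace RAM

/-- The stored numbers are exponential in `n`, but their bit lengths are polynomial. -/
theorem storeBound_lt (N n k : ℕ) : storeBound N n k < 2 ^ (N + 4 * n + n * n + 2 * k + 3) := by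
  have h1 := Nat.lt_two_pow_self (n := N + 3 * n + n * n + k)
  have h2 := Nat.lt_two_pow_self (n := k + 1)
  have h3 : 2 ^ (N + 3 * n + n * n + k) ≤ 2 ^ (N + 4 * n + n * n + 2 * k + 2) :=
    Nat.pow_le_pow_right two_pos (by omega)
  have h4 : 2 * (2 ^ (k + 1) * 2 ^ n) ≤ 2 ^ (N + 4 * n + n * n + 2 * k + 2) := by
    rw [← pow_add, ← pow_succ']
    exact Nat.pow_le_pow_right two_pos (by omega)
  have h5 : (k + 1) * 2 ^ n ≤ 2 ^ (k + 1) * 2 ^ n := Nat.mul_le_mul_right _ h2.le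
  have h6 : 2 ^ (N + 4 * n + n * n + 2 * k + 3) = 2 * 2 ^ (N + 4 * n + n * n + 2 * k + 2) := by
    rw [← pow_succ']
  unfold storeBound
  omega

/-- With `K = k + 1` there are `O(K² (g + 1))` rounds, each of `O(K²)` unit operations on numbers
with `O(K²)` bits; this gives the exponent `6`. Set-up and read-out are of lower order. -/
theorem time_le {N n k L M g : ℕ} (hn : n ≤ 5 * k + 2) (hN : N ≤ n + 1 + n * n)
    (hL : L = N + 4 * n + n * n + 2 * k + 3) (hM : M = (1 + n * g) * (k + 1)) :
    (n * 24 + 50) * (L + (n * 24 + 50) + 1) +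
        (M + 1) * ((n * (n * 30 + 200) + 104) * (L + n * (n * 30 + 200) + 105)) +
        (k * 40 + 100) * (L + (k * 40 + 100) + 1) ≤ 10 ^ 8 * (k + 1) ^ 6 * (g + 1) := by
  obtain ⟨K, hK⟩ : ∃ K, K = k + 1 := ⟨_, rfl⟩
  have hn' : n ≤ 5 * K := by omega
  have hnn : n * n ≤ 25 * (K * K) := by nlinarith
  have hKK : K ≤ K * K := by nlinarith
  have hL' : L ≤ 100 * (K * K) := by omega
  have h1 : n * (n * 30 + 200) ≤ 1750 * (K * K) := by nlinarith
  have h2 : (n * (n * 30 + 200) + 104) * (L + n * (n * 30 + 200) + 105) ≤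
      (1854 * (K * K)) * (1955 * (K * K)) := Nat.mul_le_mul (by omega) (by omega)
  have h3 : (n * 24 + 50) * (L + (n * 24 + 50) + 1) ≤ (170 * (K * K)) * (271 * (K * K)) :=
    Nat.mul_le_mul (by omega) (by omega)
  have h4 : (k * 40 + 100) * (L + (k * 40 + 100) + 1) ≤ (100 * (K * K)) * (201 * (K * K)) :=
    Nat.mul_le_mul (by omega) (by omega)
  have h5 : n * g ≤ 5 * K * g := Nat.mul_le_mul_right _ hn'
  have h6 : M + 1 ≤ 7 * (K * K) * (g + 1) := by
    rw [hM, ← hK]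
    calc (1 + n * g) * K + 1 ≤ (K + 5 * K * g) * K + K * K := by
          gcongr <;> omega
      _ ≤ 7 * (K * K) * (g + 1) := by nlinarith [Nat.zero_le (K * K * g)]
  have h7 : (M + 1) * ((n * (n * 30 + 200) + 104) * (L + n * (n * 30 + 200) + 105)) ≤
      7 * (K * K) * (g + 1) * ((1854 * (K * K)) * (1955 * (K * K))) := Nat.mul_le_mul h6 h2
  have h8 : (K * K) * (K * K) ≤ (K * K) * ((K * K) * (K * K)) * (g + 1) := by
    calc (K * K) * (K * K) = (K * K) * ((K * K) * 1) * 1 := by ring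
      _ ≤ _ := by gcongr <;> nlinarith
  rw [← hK]
  have h9 : K ^ 6 * (g + 1) = (K * K) * ((K * K) * (K * K)) * (g + 1) := by ring
  nlinarith

end RAM

/-- One program of the random access machine, on every connected graph `G` with `n ≤ 5k + 2`
vertices (given by adjacency lists) and every natural number `k`, halts after time
`O(2 ^ (2.5551 k))`. Register `0` then tells whether `ola⁺(G) ≤ k` (`1` for yes, `0` for no), and in
the case of yes register `1` contains `ola⁺(G)`. -/
theorem theorem3p6 :
    ∃ (p : RAM.Prog) (C : ℝ), ∀ (k n : ℕ) (G : SimpleGraph (Fin n)),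
      G.Connected → n ≤ 5 * k + 2 →
      ∀ s : RAM.State, RAM.IsInput G k s →
        ∃ (s' : RAM.State) (t : ℕ), RAM.Exec p s s' t ∧
          (t : ℝ) ≤ C * (2 : ℝ) ^ ((2.5551 : ℝ) * (k : ℝ)) ∧
          (olaPlus G ≤ k → s'.reg 0 = 1 ∧ s'.reg 1 = olaPlus G) ∧
          (¬ olaPlus G ≤ k → s'.reg 0 = 0) := by
  -- `300000 / 59049` is `3 * (10 / 9) ^ 5`, the growth rate of the number of expanded sets.
  obtain ⟨C, hC0, hC⟩ := exists_pow_mul_pow_le 6 (r := 300000 / 59049) (R := 11 / 2)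
    (by norm_num) (by norm_num)
  -- `201` is `200 + 1`: the count of expanded sets has the prefactor `2 * 3 ^ 4 * (10 / 9) ^ 2 =
  -- 200`, and `time_le` contains `g + 1`.
  refine ⟨RAM.olaProgram, 10 ^ 8 * 201 * C, fun k n G hG hn s hs => ?_⟩
  obtain ⟨F, hF, hFcard⟩ := hs.exists_reachCodes_subset
  set g := (Finset.univ.filter
    fun S : Finset (Fin n) => 2 * (cutPairs G S).card ≤ k + 4).card with hg
  obtain ⟨s', t, hexec, ht, hyes, hno⟩ := RAM.olaProgram_exec hs.isAdjacency rfl hs.rest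
    (RAM.storeBound_lt _ n k) hF hFcard hs.reg_zero hs.reg_one hs.reg_rest rfl
  refine ⟨s', t, hexec, ?_, fun h => hyes _ (hs.isLeast_reach h), fun h => hno (hs.not_reach h)⟩
  have ht' := ht.trans (RAM.time_le hn hs.mem_le rfl rfl)
  have hgle : (g : ℝ) ≤ 200 * (300000 / 59049) ^ k := by
    calc (g : ℝ) ≤ 2 * 3 ^ (k + 4) * (10 / 9) ^ Fintype.card (Fin n) :=
          card_filter_cutPairs_le hG (k + 4)
      _ ≤ 2 * 3 ^ (k + 4) * (10 / 9) ^ (5 * k + 2) := by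
          rw [Fintype.card_fin]
          gcongr
          norm_num
      _ = 200 * (3 * (10 / 9) ^ 5) ^ k := by
          rw [mul_pow, ← pow_mul, pow_add, pow_add]
          ring
      _ = _ := by norm_num
  have hone : (1 : ℝ) ≤ (300000 / 59049) ^ k := one_le_pow₀ (by norm_num)
  calc (t : ℝ) ≤ 10 ^ 8 * ((k : ℝ) + 1) ^ 6 * (g + 1) := by exact_mod_cast ht'
    _ ≤ 10 ^ 8 * ((k : ℝ) + 1) ^ 6 * (201 * (300000 / 59049) ^ k) := by
        gcongr
        linarith
    _ = 10 ^ 8 * 201 * (((k : ℝ) + 1) ^ 6 * (300000 / 59049) ^ k) := by ring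
    _ ≤ 10 ^ 8 * 201 * (C * (11 / 2) ^ k) :=
        mul_le_mul_of_nonneg_left (hC k) (by norm_num)
    _ ≤ 10 ^ 8 * 201 * (C * (2 : ℝ) ^ ((2.5551 : ℝ) * (k : ℝ))) := by
        gcongr
        exact pow_le_two_rpow k
    _ = _ := by ring
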